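/- Let $X$ be a CAT(0) space: a metric space in which any two points are joined by a geodesic (a curve $\alpha$ with $d(\alpha(s),\alpha(s'))=|s-s'|$), and in which the distance between two points of a geodesic triangle is at most the distance between the corresponding points of the triangle with the same side lengths in the Euclidean plane. For $x,z\neq y$ in $X$, the angle at $y$ between the geodesics $[y,x]$ and $[y,z]$ is the greatest lower bound, over $u\in[y,x]\setminus\{y\}$ and $v\in[y,z]\setminus\{y\}$, of the angle at the vertex corresponding to $y$ in the Euclidean triangle with side lengths $d(y,u),d(y,v),d(u,v)$. The total rotation of a polygonal curve with successive vertices $v_0,\dots,v_n$ ($v_i\ne v_{i+1}$) is $\sum_{i=1}^{n-1}(\pi-\beta_i)$, where $\beta_i$ is the angle at $v_i$ between $[v_i,v_{i-1}]$ and $[v_i,v_{i+1}]$. The total curvature of a curve $\gamma:[a,b]\to X$ is the $\limsup$, as the maximum segment length tends to $0$, of the total rotations of the polygonal curves inscribed in $\gamma$, that is, with vertices $\gamma(u_0),\dots,\gamma(u_n)$ where $a=u_0<\dots<u_n=b$. Let $\gamma:[0,\infty)\to X$ be a curve parametrized by arclength, let $\tau(t)$ be the total curvature of $\gamma|_{[0,t]}$,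 and let $c(t)$ be the smallest $r$ such that $\gamma([0,t])$ lies in the closed ball of radius $r$ about $\gamma(0)$. Suppose that $\gamma$ has finite total curvature $\tau_\gamma=\lim_{t\to\infty}\tau(t)<\infty$. A geodesic ray is a map $\sigma:[0,\infty)\to X$ with $d(\sigma(s),\sigma(s'))=|s-s'|$ for all $s,s'\ge 0$, and $d(\gamma(t),\sigma)$ denotes the distance from $\gamma(t)$ to its image. Then: (a) If $X$ is complete, then for every point $p\in X$ there is a geodesic ray $\sigma$ starting at $p$ such that $d(\gamma(t),\sigma)=o(t)$ as $t\to\infty$. (b) $c\in\Omega(t)$, that is, there are $A>0$ and $t_0$ with $c(t)\ge At$ for all $t\ge t_0$. (c) If $\int_0^\infty(\tau_\gamma-\tau(t))\,dt<\infty$, then $\gamma$ is asymptotic to every geodesic ray $\sigma$ with $d(\gamma(t),\sigma)=o(t)$, in particular to those in (a); that is, $d(\gamma(t),\sigma)$ is bounded on $[0,\infty)$. -/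

import Mathlib

open scoped ENNReal NNReal Topology Asymptotics

namespace CatZero

/-- `σ`, restricted to `[0, dist x y]`, is a (unit-speed, minimizing) geodesic from `x` to `y`. -/
def IsGeodesicFromTo {X : Type*} [MetricSpace X] (σ : ℝ → X) (x y : X) : Prop :=
  σ 0 = x ∧ σ (dist x y) = y ∧
    ∀ s ∈ Set.Icc 0 (dist x y), ∀ t ∈ Set.Icc 0 (dist x y), dist (σ s) (σ t) = |s - t|

/-- The points lying on a geodesic from `x` to `y` (in a CAT(0) space this geodesic is unique). -/
def geodesicSegment {X : Type*} [MetricSpace X] (x y : X) : Set X :=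
  {z | ∃ σ : ℝ → X, IsGeodesicFromTo σ x y ∧ z ∈ σ '' Set.Icc 0 (dist x y)}

/-- A geodesic metric space is CAT(0) if the distance between two points `u`, `v` of a geodesic
triangle `p q r` is at most the distance between the corresponding points `u'`, `v'` of a model
triangle `p' q' r'` in the Euclidean plane. Up to relabelling the vertices, points on two
different sides are `u ∈ [p, q]` and `v ∈ [p, r]`; for two points on one side there is nothing
to require. -/
structure IsCAT0 (X : Type*) [MetricSpace X] : Prop where
  exists_geodesic : ∀ x y : X, ∃ σ : ℝ → X, IsGeodesicFromTo σ x y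
  dist_le_model : ∀ p q r u v : X, u ∈ geodesicSegment p q → v ∈ geodesicSegment p r →
    ∀ p' q' r' u' v' : EuclideanSpace ℝ (Fin 2),
      dist p' q' = dist p q → dist p' r' = dist p r → dist q' r' = dist q r →
      dist p' u' = dist p u → dist u' q' = dist u q →
      dist p' v' = dist p v → dist v' r' = dist v r →
      dist u v ≤ dist u' v'

/-- The angle at the vertex corresponding to `y` in a Euclidean model triangle of `u y v`,
for `u ≠ y` and `v ≠ y`. -/
noncomputable def modelAngle {X : Type*} [MetricSpace X] (u y v : X) : ℝ :=
  Real.arccos ((dist y u ^ 2 + dist y v ^ 2 - dist u v ^ 2) / (2 * dist y u * dist y v))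

/-- The angle at `y` between the geodesics from `y` to `x` and from `y` to `z`, for `x ≠ y` and
`z ≠ y`: the greatest lower bound of the model angles of the triangles cut off by
initial subsegments of the two geodesics. -/
noncomputable def angle {X : Type*} [MetricSpace X] (x y z : X) : ℝ :=
  sInf {θ | ∃ u ∈ geodesicSegment y x, ∃ v ∈ geodesicSegment y z,
    u ≠ y ∧ v ≠ y ∧ θ = modelAngle u y v}

/-- The total rotation of the polygonal curve with successive vertices `v 0, …, v n`: the sum of
`π - βᵢ` over the angles `βᵢ` at the interior vertices `v 1, …, v (n - 1)`. -/
noncomputable def totalRotation {X : Type*} [MetricSpace X] (n : ℕ) (v : ℕ → X) : ℝ :=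
  ∑ i ∈ Finset.range (n - 1), (Real.pi - angle (v i) (v (i + 1)) (v (i + 2)))

/-- The parameters `a = u 0 < u 1 < ⋯ < u n = b` define a polygonal curve inscribed in
`γ` restricted to `[a, b]`, none of whose segments degenerates to a point. -/
structure IsInscribed {X : Type*} [MetricSpace X] (γ : ℝ → X) (a b : ℝ) (n : ℕ) (u : ℕ → ℝ) :
    Prop where
  first : u 0 = a
  last : u n = b
  lt_succ : ∀ i < n, u i < u (i + 1)
  ne_succ : ∀ i < n, γ (u i) ≠ γ (u (i + 1))

/-- The total curvature of `γ` restricted to `[a, b]`: the limsup of the total rotations of the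
inscribed polygonal curves as the maximum segment length tends to `0`. -/
noncomputable def totalCurvature {X : Type*} [MetricSpace X] (γ : ℝ → X) (a b : ℝ) : ℝ≥0∞ :=
  ⨅ (δ : ℝ) (_ : 0 < δ), ⨆ (n : ℕ) (u : ℕ → ℝ) (_ : IsInscribed γ a b n u)
    (_ : ∀ i < n, dist (γ (u i)) (γ (u (i + 1))) < δ),
    ENNReal.ofReal (totalRotation n fun i => γ (u i))

/-- The circumradius function: the smallest `r` such that `γ` restricted to `[0, t]` lies in the
ball of radius `r` about `γ 0`. -/
noncomputable def circumradius {X : Type*} [MetricSpace X] (γ : ℝ → X) (t : ℝ) : ℝ :=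
  sInf {r | γ '' Set.Icc 0 t ⊆ Metric.closedBall (γ 0) r}

/-- `σ`, restricted to `[0, ∞)`, is a geodesic ray. -/
def IsGeodesicRay {X : Type*} [MetricSpace X] (σ : ℝ → X) : Prop :=
  ∀ s, 0 ≤ s → ∀ t, 0 ≤ t → dist (σ s) (σ t) = |s - t|

/-- The distance from a point to (the image of) a ray defined on `[0, ∞)`. -/
noncomputable def distToRay {X : Type*} [MetricSpace X] (x : X) (σ : ℝ → X) : ℝ :=
  Metric.infDist x (σ '' Set.Ici 0)

/-- The curve `γ` on `[0, ∞)` is asymptotic to the ray `σ`. -/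
def IsAsymptotic {X : Type*} [MetricSpace X] (γ σ : ℝ → X) : Prop :=
  ∃ C : ℝ, ∀ t, 0 ≤ t → distToRay (γ t) σ ≤ C

end CatZero

/-!
Cone a polygonal curve `v 0, …, v n` from its initial vertex. In a Euclidean model triangle
`v 0, v i, v (i + 1)` the angles sum to `π`, and they dominate the angles of `X`; with the triangle
inequality for angles, induction shows that the angle between the last edge and the chord
`[v 0, v n]`, plus the sum of all model angles at the apex `v 0`, is at most the total rotation, as
long as the latter is at most `π / 2`. If the total rotation is at most `K ≤ π / 2`, this has two
consequences. The distance from `v 0` grows at a rate of at least `cos K` along the polygonal curve.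
And, moving between successive chords at constant distance from `v 0`, one sees that every vertex
`v j` lies within `K * dist (v 0) (v j)` of the chord `[v 0, v n]`. Both facts pass to curves
parametrized by arclength.

Total curvature is superadditive, so the final arcs of a curve `γ` of finite total curvature have
small total curvature. The first consequence then gives linear growth of `dist p (γ t)`, hence of
the circumradius, and the second shows that the segments `[p, γ t]` converge to a ray at sublinear
distance from `γ`. If `σ` is any such ray and `f t` is the distance from `γ t` to `σ`, then `f s'`
is estimated by convexity along the chord `[γ s, γ t]`; letting `t → ∞` gives
`f s' ≤ f s + (s' - s) * K`, where `K` exceeds the total curvature beyond `s`. These increments,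
taken between consecutive integers, are summable if the remaining curvature is integrable.
-/

namespace CatZero

open Filter Set Real

section Metric

variable {X : Type*} [MetricSpace X]

/-! ### Euclidean model triangles -/

theorem modelAngle_nonneg (u y v : X) : 0 ≤ modelAngle u y v := arccos_nonneg _

theorem modelAngle_le_pi (u y v : X) : modelAngle u y v ≤ π := arccos_le_pi _

theorem modelAngle_comm (u y v : X) : modelAngle u y v = modelAngle v y u := by
  unfold modelAngle
  rw [dist_comm u v]
  congr 1
  ring

theorem modelAngle_self {u y : X} (hu : u ≠ y) : modelAngle u y u = 0 := by
  have hd : dist y u ≠ 0 := dist_ne_zero.2 hu.symm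
  rw [modelAngle, dist_self, arccos_eq_zero]
  exact le_of_eq (by field_simp; norm_num)

theorem dist_sq_eq_modelAngle (y u v : X) :
    dist u v ^ 2 = dist y u ^ 2 + dist y v ^ 2
      - 2 * dist y u * dist y v * cos (modelAngle u y v) := by
  rcases eq_or_ne y u with rfl | hu
  · simp
  rcases eq_or_ne y v with rfl | hv
  · simp [dist_comm]
  have hu0 : 0 < dist y u := dist_pos.2 hu
  have hv0 : 0 < dist y v := dist_pos.2 hv
  have h₁ : |dist y u - dist y v| ≤ dist u v := by
    simpa only [dist_comm y] using abs_dist_sub_le u v y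
  have h₂ : dist u v ≤ dist y u + dist y v := dist_triangle_left u v y
  have hlow : (dist y u - dist y v) ^ 2 ≤ dist u v ^ 2 := sq_le_sq.2 (h₁.trans (le_abs_self _))
  have hup : dist u v ^ 2 ≤ (dist y u + dist y v) ^ 2 := by gcongr
  rw [modelAngle, cos_arccos]
  · field_simp
    ring
  · rw [le_div_iff₀ (by positivity)]
    linarith
  · rw [div_le_iff₀ (by positivity)]
    linarith

theorem modelAngle_le_iff {u y v : X} (hu : u ≠ y) (hv : v ≠ y) {α : ℝ} (hα : α ∈ Icc 0 π) :
    modelAngle u y v ≤ α ↔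
      dist u v ^ 2 ≤ dist y u ^ 2 + dist y v ^ 2 - 2 * dist y u * dist y v * cos α := by
  have hd : 0 < 2 * dist y u * dist y v :=
    mul_pos (mul_pos two_pos (dist_pos.2 hu.symm)) (dist_pos.2 hv.symm)
  rw [dist_sq_eq_modelAngle y u v, sub_le_sub_iff_left, mul_le_mul_iff_right₀ hd,
    strictAntiOn_cos.le_iff_ge hα ⟨modelAngle_nonneg u y v, modelAngle_le_pi u y v⟩]

theorem exists_model_triangle (p q r : X) : ∃ p' q' r' : EuclideanSpace ℝ (Fin 2),
    dist p' q' = dist p q ∧ dist p' r' = dist p r ∧ dist q' r' = dist q r := by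
  set θ := modelAngle q p r
  have hθ := sin_sq_add_cos_sq θ
  refine ⟨0, !₂[dist p q, 0], !₂[dist p r * cos θ, dist p r * sin θ], ?_, ?_, ?_⟩ <;>
    rw [← sq_eq_sq₀ dist_nonneg dist_nonneg, EuclideanSpace.dist_sq_eq, Fin.sum_univ_two]
  · simp [Real.dist_eq]
  · simp only [Real.dist_eq, sq_abs, PiLp.zero_apply, Matrix.cons_val_zero, Matrix.cons_val_one,
      zero_sub, neg_sq]
    linear_combination dist p r ^ 2 * hθ
  · simp only [Real.dist_eq, sq_abs, Matrix.cons_val_zero, Matrix.cons_val_one, zero_sub, neg_sq]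
    linear_combination dist p r ^ 2 * hθ - dist_sq_eq_modelAngle p q r

section Euclidean

variable {V P : Type*} [NormedAddCommGroup V] [InnerProductSpace ℝ V] [MetricSpace P]
  [NormedAddTorsor V P]

theorem modelAngle_eq_angle {p q r : X} {p' q' r' : P} (hpq : dist p' q' = dist p q)
    (hpr : dist p' r' = dist p r) (hqr : dist q' r' = dist q r) :
    modelAngle q p r = EuclideanGeometry.angle q' p' r' := by
  rw [modelAngle, EuclideanGeometry.angle, InnerProductGeometry.angle,
    real_inner_eq_norm_mul_self_add_norm_mul_self_sub_norm_sub_mul_self_div_two,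
    vsub_sub_vsub_cancel_right, ← dist_eq_norm_vsub V, ← dist_eq_norm_vsub V, ← dist_eq_norm_vsub V,
    dist_comm q' p', dist_comm r' p', hpq, hpr, hqr]
  congr 1
  ring

theorem dist_lineMap_lineMap_sq (p q r : P) (l m : ℝ) :
    dist (AffineMap.lineMap p q l) (AffineMap.lineMap p r m) ^ 2 =
      (l * dist p q) ^ 2 + (m * dist p r) ^ 2
        - 2 * (l * dist p q) * (m * dist p r) * cos (EuclideanGeometry.angle q p r) := by
  have hinner := InnerProductGeometry.cos_angle_mul_norm_mul_norm (q -ᵥ p) (r -ᵥ p)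
  rw [dist_eq_norm_vsub V, AffineMap.lineMap_apply, AffineMap.lineMap_apply,
    vadd_vsub_vadd_cancel_right, norm_sub_sq_real, inner_smul_left, inner_smul_right, norm_smul,
    norm_smul, mul_pow, mul_pow, norm_eq_abs, norm_eq_abs, sq_abs, sq_abs, dist_comm p q,
    dist_comm p r, dist_eq_norm_vsub V q p, dist_eq_norm_vsub V r p, EuclideanGeometry.angle,
    conj_trivial]
  linear_combination 2 * l * m * hinner

end Euclidean

theorem modelAngle_sum {p q : X} (r : X) (h : q ≠ p) :
    modelAngle p q r + modelAngle q r p + modelAngle r p q = π := by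
  obtain ⟨p', q', r', hpq, hpr, hqr⟩ := exists_model_triangle p q r
  have hqp : dist q' p' = dist q p := by rwa [dist_comm, dist_comm q]
  have hrp : dist r' p' = dist r p := by rwa [dist_comm, dist_comm r]
  have hrq : dist r' q' = dist r q := by rwa [dist_comm, dist_comm r]
  rw [modelAngle_eq_angle hqp hqr hpr, modelAngle_eq_angle hrq hrp hqp,
    modelAngle_eq_angle hpr hpq hrq]
  refine EuclideanGeometry.angle_add_angle_add_angle_eq_pi r' ?_
  rwa [← dist_pos, hqp, dist_pos]

/-! ### Geodesic segments -/

theorem IsGeodesicFromTo.dist_left {σ : ℝ → X} {x y : X} (h : IsGeodesicFromTo σ x y) {s : ℝ}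
    (hs : s ∈ Icc 0 (dist x y)) : dist x (σ s) = s := by
  have := h.2.2 0 ⟨le_rfl, dist_nonneg⟩ s hs
  rwa [h.1, zero_sub, abs_neg, abs_of_nonneg hs.1] at this

theorem IsGeodesicFromTo.dist_right {σ : ℝ → X} {x y : X} (h : IsGeodesicFromTo σ x y) {s : ℝ}
    (hs : s ∈ Icc 0 (dist x y)) : dist (σ s) y = dist x y - s := by
  have := h.2.2 s hs (dist x y) ⟨dist_nonneg, le_rfl⟩
  rwa [h.2.1, abs_sub_comm, abs_of_nonneg (sub_nonneg.2 hs.2)] at this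

theorem IsGeodesicFromTo.mem_geodesicSegment {σ : ℝ → X} {x y : X} (h : IsGeodesicFromTo σ x y)
    {s : ℝ} (hs : s ∈ Icc 0 (dist x y)) : σ s ∈ geodesicSegment x y :=
  ⟨σ, h, mem_image_of_mem σ hs⟩

theorem IsGeodesicFromTo.symm {σ : ℝ → X} {x y : X} (h : IsGeodesicFromTo σ x y) :
    IsGeodesicFromTo (fun t => σ (dist x y - t)) y x := by
  refine ⟨by simpa using h.2.1, by simpa [dist_comm y x] using h.1, fun s hs t ht => ?_⟩
  rw [dist_comm y x] at hs ht
  rw [h.2.2 _ ⟨by linarith [hs.2], by linarith [hs.1]⟩ _ ⟨by linarith [ht.2], by linarith [ht.1]⟩,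
    sub_sub_sub_cancel_left, abs_sub_comm]

theorem IsGeodesicFromTo.restrict {σ : ℝ → X} {x y : X} (h : IsGeodesicFromTo σ x y) {s : ℝ}
    (hs : s ∈ Icc 0 (dist x y)) : IsGeodesicFromTo σ x (σ s) := by
  refine ⟨h.1, by rw [h.dist_left hs], ?_⟩
  rw [h.dist_left hs]
  exact fun a ha b hb => h.2.2 a ⟨ha.1, ha.2.trans hs.2⟩ b ⟨hb.1, hb.2.trans hs.2⟩

theorem geodesicSegment_comm (x y : X) : geodesicSegment x y = geodesicSegment y x := by
  suffices h : ∀ x y : X, geodesicSegment x y ⊆ geodesicSegment y x from (h x y).antisymm (h y x)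
  rintro x y _ ⟨σ, hσ, s, hs, rfl⟩
  refine ⟨_, hσ.symm, dist x y - s, ⟨by linarith [hs.2], ?_⟩, by simp⟩
  linarith [hs.1, dist_comm x y]

theorem dist_add_dist_of_mem_segment {x y u : X} (h : u ∈ geodesicSegment x y) :
    dist x u + dist u y = dist x y := by
  obtain ⟨σ, hσ, s, hs, rfl⟩ := h
  rw [hσ.dist_left hs, hσ.dist_right hs, add_sub_cancel]

theorem dist_le_of_mem_segment {x y u : X} (h : u ∈ geodesicSegment x y) : dist x u ≤ dist x y := by
  linarith [dist_add_dist_of_mem_segment h, dist_nonneg (x := u) (y := y)]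

theorem dist_eq_mul_of_mem_segment {x y u : X} (h : u ∈ geodesicSegment x y) :
    ∃ l ∈ Icc (0 : ℝ) 1, dist x u = l * dist x y ∧ dist u y = (1 - l) * dist x y := by
  have hadd := dist_add_dist_of_mem_segment h
  have hle := dist_le_of_mem_segment h
  refine ⟨dist x u / dist x y, ⟨by positivity, div_le_one_of_le₀ hle dist_nonneg⟩, ?_⟩
  have hmul : dist x u = dist x u / dist x y * dist x y :=
    (div_mul_cancel_of_imp fun h0 => le_antisymm (hle.trans_eq h0) dist_nonneg).symm
  exact ⟨hmul, by linarith⟩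

theorem IsCAT0.exists_mem_segment (hX : IsCAT0 X) {x y : X} {s : ℝ} (hs : s ∈ Icc 0 (dist x y)) :
    ∃ u ∈ geodesicSegment x y, dist x u = s := by
  obtain ⟨σ, hσ⟩ := hX.exists_geodesic x y
  exact ⟨σ s, hσ.mem_geodesicSegment hs, hσ.dist_left hs⟩

theorem IsCAT0.left_mem_segment (hX : IsCAT0 X) (x y : X) : x ∈ geodesicSegment x y := by
  obtain ⟨σ, hσ⟩ := hX.exists_geodesic x y
  exact ⟨σ, hσ, 0, ⟨le_rfl, dist_nonneg⟩, hσ.1⟩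

theorem IsCAT0.right_mem_segment (hX : IsCAT0 X) (x y : X) : y ∈ geodesicSegment x y :=
  geodesicSegment_comm y x ▸ hX.left_mem_segment y x

/-! ### Comparison -/

theorem IsCAT0.dist_sq_le_modelAngle (hX : IsCAT0 X) {p q r u v : X} (hu : u ∈ geodesicSegment p q)
    (hv : v ∈ geodesicSegment p r) : dist u v ^ 2 ≤ dist p u ^ 2 + dist p v ^ 2
      - 2 * dist p u * dist p v * cos (modelAngle q p r) := by
  obtain ⟨p', q', r', hpq, hpr, hqr⟩ := exists_model_triangle p q r
  obtain ⟨l, hl, hpu, huq⟩ := dist_eq_mul_of_mem_segment hu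
  obtain ⟨m, hm, hpv, hvr⟩ := dist_eq_mul_of_mem_segment hv
  have hmodel := hX.dist_le_model p q r u v hu hv p' q' r' (AffineMap.lineMap p' q' l)
    (AffineMap.lineMap p' r' m) hpq hpr hqr
    (by rw [dist_left_lineMap, norm_of_nonneg hl.1, hpq, hpu])
    (by rw [dist_lineMap_right, norm_of_nonneg (sub_nonneg.2 hl.2), hpq, huq])
    (by rw [dist_left_lineMap, norm_of_nonneg hm.1, hpr, hpv])
    (by rw [dist_lineMap_right, norm_of_nonneg (sub_nonneg.2 hm.2), hpr, hvr])
  calc dist u v ^ 2 ≤ dist (AffineMap.lineMap p' q' l) (AffineMap.lineMap p' r' m) ^ 2 := by gcongr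
    _ = _ := by
      rw [dist_lineMap_lineMap_sq, ← modelAngle_eq_angle hpq hpr hqr, hpq, hpr, hpu, hpv]

theorem IsCAT0.dist_le_abs_sub (hX : IsCAT0 X) {p q u v : X} (hu : u ∈ geodesicSegment p q)
    (hv : v ∈ geodesicSegment p q) : dist u v ≤ |dist p u - dist p v| := by
  rcases eq_or_ne q p with rfl | hqp
  · have hu0 : q = u := dist_le_zero.1 ((dist_le_of_mem_segment hu).trans_eq (dist_self q))
    have hv0 : q = v := dist_le_zero.1 ((dist_le_of_mem_segment hv).trans_eq (dist_self q))
    simp [← hu0, ← hv0]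
  · have h := hX.dist_sq_le_modelAngle hu hv
    rw [modelAngle_self hqp, cos_zero] at h
    rw [← abs_of_nonneg (dist_nonneg (x := u) (y := v)), ← sq_le_sq]
    exact h.trans_eq (by ring)

theorem IsCAT0.eq_of_mem_segment (hX : IsCAT0 X) {p q u v : X} (hu : u ∈ geodesicSegment p q)
    (hv : v ∈ geodesicSegment p q) (h : dist p u = dist p v) : u = v := by
  simpa [h] using hX.dist_le_abs_sub hu hv

theorem IsCAT0.mem_segment_of_dist_le (hX : IsCAT0 X) {p q u w : X}
    (hu : u ∈ geodesicSegment p q) (hw : w ∈ geodesicSegment p q) (h : dist p w ≤ dist p u) :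
    w ∈ geodesicSegment p u := by
  obtain ⟨σ, hσ, s, hs, rfl⟩ := hu
  have hpw : dist p w ∈ Icc 0 (dist p q) := ⟨dist_nonneg, dist_le_of_mem_segment hw⟩
  rw [hX.eq_of_mem_segment hw (hσ.mem_geodesicSegment hpw) (hσ.dist_left hpw).symm]
  exact (hσ.restrict hs).mem_geodesicSegment ⟨dist_nonneg, h⟩

theorem IsCAT0.dist_le_mul (hX : IsCAT0 X) {p q r u v : X} (hu : u ∈ geodesicSegment p q)
    (hv : v ∈ geodesicSegment p r) {l : ℝ} (hl : 0 ≤ l) (hul : dist p u = l * dist p q)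
    (hvl : dist p v = l * dist p r) : dist u v ≤ l * dist q r := by
  refine le_of_sq_le_sq (α := ℝ) ?_ (mul_nonneg hl dist_nonneg)
  calc dist u v ^ 2
      ≤ dist p u ^ 2 + dist p v ^ 2 - 2 * dist p u * dist p v * cos (modelAngle q p r) :=
        hX.dist_sq_le_modelAngle hu hv
    _ = (l * dist q r) ^ 2 := by
        rw [mul_pow, dist_sq_eq_modelAngle p q r, hul, hvl]
        ring

theorem IsCAT0.dist_le_convex (hX : IsCAT0 X) {p q p' q' u v : X} (hu : u ∈ geodesicSegment p q)
    (hv : v ∈ geodesicSegment p' q') {l : ℝ} (hl : l ∈ Icc (0 : ℝ) 1)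
    (hul : dist p u = l * dist p q) (hvl : dist p' v = l * dist p' q') :
    dist u v ≤ (1 - l) * dist p p' + l * dist q q' := by
  obtain ⟨w, hw, hwl⟩ := hX.exists_mem_segment (x := p) (y := q') (s := l * dist p q')
    ⟨mul_nonneg hl.1 dist_nonneg, mul_le_of_le_one_left dist_nonneg hl.2⟩
  have huw : dist u w ≤ l * dist q q' := hX.dist_le_mul hu hw hl.1 hul hwl
  have hw' := dist_add_dist_of_mem_segment hw
  have hv' := dist_add_dist_of_mem_segment hv
  rw [geodesicSegment_comm] at hw hv
  have hwv : dist w v ≤ (1 - l) * dist p p' := hX.dist_le_mul hw hv (sub_nonneg.2 hl.2)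
    (by rw [dist_comm q' w, dist_comm q' p]; linarith)
    (by rw [dist_comm q' v, dist_comm q' p']; linarith)
  linarith [dist_triangle u w v]

theorem IsCAT0.modelAngle_mono (hX : IsCAT0 X) {y x z u v : X} (hu : u ∈ geodesicSegment y x)
    (hv : v ∈ geodesicSegment y z) (huy : u ≠ y) (hvy : v ≠ y) :
    modelAngle u y v ≤ modelAngle x y z :=
  (modelAngle_le_iff huy hvy ⟨modelAngle_nonneg _ _ _, modelAngle_le_pi _ _ _⟩).2
    (hX.dist_sq_le_modelAngle hu hv)

/-! ### Angles -/

theorem angle_bddBelow (x y z : X) : BddBelow {θ | ∃ u ∈ geodesicSegment y x,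
    ∃ v ∈ geodesicSegment y z, u ≠ y ∧ v ≠ y ∧ θ = modelAngle u y v} :=
  ⟨0, by rintro _ ⟨u, _, v, _, _, _, rfl⟩; exact modelAngle_nonneg _ _ _⟩

theorem angle_nonneg (x y z : X) : 0 ≤ angle x y z :=
  Real.sInf_nonneg (by rintro _ ⟨u, _, v, _, _, _, rfl⟩; exact modelAngle_nonneg _ _ _)

theorem angle_le_modelAngle_of_mem {x y z u v : X} (hu : u ∈ geodesicSegment y x)
    (hv : v ∈ geodesicSegment y z) (huy : u ≠ y) (hvy : v ≠ y) : angle x y z ≤ modelAngle u y v :=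
  csInf_le (angle_bddBelow x y z) ⟨u, hu, v, hv, huy, hvy, rfl⟩

theorem angle_le_pi (x y z : X) : angle x y z ≤ π := by
  by_cases h : ∃ u ∈ geodesicSegment y x, ∃ v ∈ geodesicSegment y z, u ≠ y ∧ v ≠ y
  · obtain ⟨u, hu, v, hv, huy, hvy⟩ := h
    exact (angle_le_modelAngle_of_mem hu hv huy hvy).trans (modelAngle_le_pi u y v)
  · rw [angle, show {θ | _} = (∅ : Set ℝ) from ?_, Real.sInf_empty]
    · exact pi_pos.le
    · exact eq_empty_of_forall_notMem fun _ ⟨u, hu, v, hv, huy, hvy, _⟩ =>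
        h ⟨u, hu, v, hv, huy, hvy⟩

theorem IsCAT0.angle_le_modelAngle (hX : IsCAT0 X) {x y z : X} (hx : x ≠ y) (hz : z ≠ y) :
    angle x y z ≤ modelAngle x y z :=
  angle_le_modelAngle_of_mem (hX.right_mem_segment y x) (hX.right_mem_segment y z) hx hz

theorem IsCAT0.angle_self (hX : IsCAT0 X) {x y : X} (hx : x ≠ y) : angle x y x = 0 :=
  le_antisymm ((hX.angle_le_modelAngle hx hx).trans_eq (modelAngle_self hx)) (angle_nonneg x y x)

theorem IsCAT0.eventually_modelAngle_lt (hX : IsCAT0 X) {x y z : X} (hx : x ≠ y) (hz : z ≠ y)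
    {α : ℝ} (hα : angle x y z < α) : ∀ᶠ ρ in 𝓝[>] (0 : ℝ), ∀ u ∈ geodesicSegment y x,
      ∀ v ∈ geodesicSegment y z, u ≠ y → v ≠ y → dist y u ≤ ρ → dist y v ≤ ρ →
        modelAngle u y v < α := by
  obtain ⟨_, ⟨u, hu, v, hv, huy, hvy, rfl⟩, hlt⟩ := exists_lt_of_csInf_lt (by
    exact ⟨_, x, hX.right_mem_segment y x, z, hX.right_mem_segment y z, hx, hz, rfl⟩) hα
  filter_upwards [Ioc_mem_nhdsGT (dist_pos.2 huy.symm), Ioc_mem_nhdsGT (dist_pos.2 hvy.symm)]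
    with ρ hρu hρv u' hu' v' hv' hu'y hv'y hdu' hdv'
  exact (hX.modelAngle_mono (hX.mem_segment_of_dist_le hu hu' (hdu'.trans hρu.2))
    (hX.mem_segment_of_dist_le hv hv' (hdv'.trans hρv.2)) hu'y hv'y).trans_lt hlt

/-- The isosceles triangle with legs `1` and apex angle `α + β` is divided by a cevian of length
`r` making angles `α`, `β` with the legs; `a` and `b` are the two pieces of its base. -/
theorem exists_isosceles_cevian {α β : ℝ} (hα : 0 < α) (hβ : 0 < β) (hαβ : α + β < π) :
    ∃ r ∈ Ioc (0 : ℝ) 1, ∃ a ≥ 0, ∃ b ≥ 0, 1 + r ^ 2 - 2 * r * cos α = a ^ 2 ∧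
      r ^ 2 + 1 - 2 * r * cos β = b ^ 2 ∧ (a + b) ^ 2 = 2 - 2 * cos (α + β) := by
  obtain ⟨h, k, rfl, rfl⟩ : ∃ h k : ℝ, α = h + k ∧ β = h - k :=
    ⟨(α + β) / 2, (α - β) / 2, by ring, by ring⟩
  have hcosh : 0 < cos h := cos_pos_of_mem_Ioo ⟨by linarith, by linarith⟩
  have hcosk : 0 < cos k := cos_pos_of_mem_Ioo ⟨by linarith, by linarith⟩
  have hcos : cos h ≤ cos k := by
    rw [← cos_abs k]
    exact cos_le_cos_of_nonneg_of_le_pi (abs_nonneg k) (by linarith)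
      (abs_le.2 ⟨by linarith, by linarith⟩)
  have hsinα : 0 < sin (h + k) := sin_pos_of_pos_of_lt_pi hα (by linarith)
  have hsinβ : 0 < sin (h - k) := sin_pos_of_pos_of_lt_pi hβ (by linarith)
  have hh := sin_sq_add_cos_sq h
  have hk := sin_sq_add_cos_sq k
  refine ⟨cos h / cos k, ⟨by positivity, (div_le_one hcosk).2 hcos⟩, sin (h + k) / cos k,
    by positivity, sin (h - k) / cos k, by positivity, ?_, ?_, ?_⟩
  · rw [sin_add, cos_add]
    field_simp
    grind
  · rw [sin_sub, cos_sub]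
    field_simp
    grind
  · rw [sin_add, sin_sub, show h + k + (h - k) = 2 * h by ring, cos_two_mul]
    field_simp
    grind

theorem exists_ratio_modelAngle_le_add (X : Type*) [MetricSpace X] {α β : ℝ} (hα : 0 < α)
    (hβ : 0 < β) (hαβ : α + β < π) : ∃ r ∈ Ioc (0 : ℝ) 1, ∀ y u v m : X, u ≠ y →
      dist y v = dist y u → dist y m = r * dist y u → modelAngle u y m ≤ α → modelAngle m y v ≤ β →
        modelAngle u y v ≤ α + β := by
  obtain ⟨r, hr, a, ha, b, hb, hra, hrb, hab⟩ := exists_isosceles_cevian hα hβ hαβ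
  refine ⟨r, hr, fun y u v m hu hyv hym hum hmv => ?_⟩
  have hd : 0 < dist y u := dist_pos.2 hu.symm
  have hv : v ≠ y := (dist_pos.1 (hyv ▸ hd)).symm
  have hm : m ≠ y := (dist_pos.1 (hym ▸ mul_pos hr.1 hd)).symm
  rw [modelAngle_le_iff hu hm ⟨hα.le, by linarith⟩, hym] at hum
  rw [modelAngle_le_iff hm hv ⟨hβ.le, by linarith⟩, hym, hyv] at hmv
  have hum' : dist u m ≤ dist y u * a :=
    le_of_sq_le_sq (α := ℝ) (by linear_combination hum + dist y u ^ 2 * hra) (by positivity)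
  have hmv' : dist m v ≤ dist y u * b :=
    le_of_sq_le_sq (α := ℝ) (by linear_combination hmv + dist y u ^ 2 * hrb) (by positivity)
  rw [modelAngle_le_iff hu hv ⟨by linarith, hαβ.le⟩, hyv]
  calc dist u v ^ 2 ≤ (dist y u * a + dist y u * b) ^ 2 := by
        gcongr
        exact (dist_triangle u m v).trans (add_le_add hum' hmv')
    _ = _ := by linear_combination dist y u ^ 2 * hab

theorem IsCAT0.angle_triangle (hX : IsCAT0 X) {x y z w : X} (hx : x ≠ y) (hz : z ≠ y)
    (hw : w ≠ y) : angle x y z ≤ angle x y w + angle w y z := by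
  refine le_of_forall_pos_le_add fun e he => ?_
  obtain ⟨α, hα, hαe⟩ : ∃ α, angle x y w < α ∧ α = angle x y w + e / 2 := ⟨_, by linarith, rfl⟩
  obtain ⟨β, hβ, hβe⟩ : ∃ β, angle w y z < β ∧ β = angle w y z + e / 2 := ⟨_, by linarith, rfl⟩
  suffices h : angle x y z ≤ α + β by linarith
  rcases le_or_gt π (α + β) with hπ | hπ
  · exact (angle_le_pi x y z).trans hπ
  obtain ⟨r, hr, hadd⟩ := exists_ratio_modelAngle_le_add X ((angle_nonneg x y w).trans_lt hα)
    ((angle_nonneg w y z).trans_lt hβ) hπ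
  have hsmall : ∀ {q : X}, q ≠ y → ∀ᶠ ρ in 𝓝[>] (0 : ℝ), ρ ∈ Ioc 0 (dist y q) :=
    fun hq => Ioc_mem_nhdsGT (dist_pos.2 hq.symm)
  obtain ⟨ρ, hρα, hρβ, hρx, hρz, hρw⟩ := ((hX.eventually_modelAngle_lt hx hw hα).and <|
    (hX.eventually_modelAngle_lt hw hz hβ).and <|
    (hsmall hx).and <| (hsmall hz).and (hsmall hw)).exists
  have hρ : 0 < ρ := hρx.1
  have hrρ : r * ρ ≤ ρ := mul_le_of_le_one_left hρ.le hr.2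
  have hrρ0 : 0 < r * ρ := mul_pos hr.1 hρ
  obtain ⟨u, hu, hdu⟩ := hX.exists_mem_segment (Ioc_subset_Icc_self hρx)
  obtain ⟨v, hv, hdv⟩ := hX.exists_mem_segment (Ioc_subset_Icc_self hρz)
  obtain ⟨m, hm, hdm⟩ := hX.exists_mem_segment (x := y) (y := w) ⟨hrρ0.le, hrρ.trans hρw.2⟩
  have huy : u ≠ y := (dist_pos.1 (hdu ▸ hρ)).symm
  have hvy : v ≠ y := (dist_pos.1 (hdv ▸ hρ)).symm
  have hmy : m ≠ y := (dist_pos.1 (hdm ▸ hrρ0)).symm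
  calc angle x y z ≤ modelAngle u y v := angle_le_modelAngle_of_mem hu hv huy hvy
    _ ≤ α + β := hadd y u v m huy (hdv.trans hdu.symm) (by rw [hdm, hdu])
      (hρα u hu m hm huy hmy hdu.le (hdm.trans_le hrρ)).le
      (hρβ m hm v hv hmy hvy (hdm.trans_le hrρ) hdv.le).le

/-! ### Polygons of small total rotation -/

theorem totalRotation_nonneg (n : ℕ) (v : ℕ → X) : 0 ≤ totalRotation n v :=
  Finset.sum_nonneg fun _ _ => sub_nonneg.2 (angle_le_pi _ _ _)

theorem totalRotation_add_two (n : ℕ) (v : ℕ → X) : totalRotation (n + 2) v =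
    totalRotation (n + 1) v + (π - angle (v n) (v (n + 1)) (v (n + 2))) :=
  Finset.sum_range_succ _ n

theorem totalRotation_mono {m n : ℕ} (h : m ≤ n) (v : ℕ → X) :
    totalRotation m v ≤ totalRotation n v :=
  Finset.sum_le_sum_of_subset_of_nonneg (Finset.range_mono (by omega))
    fun _ _ _ => sub_nonneg.2 (angle_le_pi _ _ _)

/-- The total angle at the apex `v 0` of the Euclidean model triangles `v 0, v (i + 1), v (i + 2)`,
`i < n`, of the cone from `v 0` over the polygonal curve `v 1, …, v (n + 1)`. -/
noncomputable def fanAngle (n : ℕ) (v : ℕ → X) : ℝ :=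
  ∑ i ∈ Finset.range n, modelAngle (v (i + 1)) (v 0) (v (i + 2))

theorem fanAngle_nonneg (n : ℕ) (v : ℕ → X) : 0 ≤ fanAngle n v :=
  Finset.sum_nonneg fun _ _ => modelAngle_nonneg _ _ _

theorem fanAngle_succ (n : ℕ) (v : ℕ → X) :
    fanAngle (n + 1) v = fanAngle n v + modelAngle (v (n + 1)) (v 0) (v (n + 2)) :=
  Finset.sum_range_succ _ n

theorem IsCAT0.dist_add_le_of_hinge (hX : IsCAT0 X) {x y z : X} (hxy : x ≠ y) (hzy : z ≠ y) {K : ℝ}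
    (hK0 : 0 ≤ K) (hK : K ≤ π / 2) (h : π - angle x y z ≤ K) :
    dist x y + cos K * dist y z ≤ dist x z := by
  have hcos : cos (modelAngle x y z) ≤ -cos K := by
    rw [← cos_pi_sub]
    exact cos_le_cos_of_nonneg_of_le_pi (by linarith) (modelAngle_le_pi _ _ _)
      (by linarith [hX.angle_le_modelAngle hxy hzy])
  refine le_of_sq_le_sq (α := ℝ) ?_ dist_nonneg
  have hxyz : 0 ≤ dist x y * dist y z := by positivity
  rw [dist_sq_eq_modelAngle y x z, dist_comm y x]
  nlinarith [mul_le_mul_of_nonneg_left hcos hxyz, sq_nonneg (dist y z), cos_sq_le_one K]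

theorem IsCAT0.angle_add_modelAngle_le (hX : IsCAT0 X) {w x y z : X} (hw : w ≠ y) (hx : x ≠ y)
    (hz : z ≠ y) (hxz : x ≠ z) :
    angle y z x + modelAngle y x z ≤ angle w y x + (π - angle w y z) := by
  have hsum := modelAngle_sum z hx.symm
  have hz' := hX.angle_le_modelAngle hz.symm hxz
  have hy' := hX.angle_le_modelAngle hx hz
  have htri := hX.angle_triangle hw hz hx
  rw [modelAngle_comm z x y] at hsum
  linarith

theorem IsCAT0.dist_add_le_of_angle_add_le (hX : IsCAT0 X) {w x y z : X} {K : ℝ} (hw : w ≠ y)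
    (hx : x ≠ y) (hz : z ≠ y) (hK : K ≤ π / 2) (h : angle w y x + (π - angle w y z) ≤ K) :
    dist x y + cos K * dist y z ≤ dist x z :=
  hX.dist_add_le_of_hinge hx hz (by linarith [angle_nonneg w y x, angle_le_pi w y z]) hK
    (by linarith [hX.angle_triangle hw hz hx])

theorem IsCAT0.angle_add_fanAngle_le (hX : IsCAT0 X) {v : ℕ → X} {n : ℕ}
    (hne : ∀ i < n + 1, v i ≠ v (i + 1)) (hrot : totalRotation (n + 1) v ≤ π / 2) :
    v 0 ≠ v (n + 1) ∧
      angle (v n) (v (n + 1)) (v 0) + fanAngle n v ≤ totalRotation (n + 1) v := by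
  induction n with
  | zero =>
    have h01 : v 0 ≠ v 1 := hne 0 one_pos
    exact ⟨h01, by simp [totalRotation, fanAngle, hX.angle_self h01]⟩
  | succ n ih =>
    have hw : v n ≠ v (n + 1) := hne n (by omega)
    have hz : v (n + 2) ≠ v (n + 1) := (hne (n + 1) (by omega)).symm
    obtain ⟨hx, hfan⟩ := ih (fun i hi => hne i (by omega))
      ((totalRotation_mono (Nat.le_succ _) v).trans hrot)
    rw [totalRotation_add_two] at hrot ⊢
    have hgrowth := hX.dist_add_le_of_angle_add_le hw hx hz le_rfl
      (by linarith [fanAngle_nonneg n v])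
    rw [cos_pi_div_two, zero_mul, add_zero] at hgrowth
    have hxz : v 0 ≠ v (n + 2) := dist_pos.1 ((dist_pos.2 hx).trans_le hgrowth)
    refine ⟨hxz, ?_⟩
    rw [fanAngle_succ]
    linarith [hX.angle_add_modelAngle_le hw hx hz hxz]

theorem IsCAT0.dist_add_le_of_totalRotation_le (hX : IsCAT0 X) {v : ℕ → X} {K : ℝ} (hK : K ≤ π / 2)
    {n : ℕ} (hne : ∀ i < n + 1, v i ≠ v (i + 1)) (hrot : totalRotation (n + 1) v ≤ K) :
    dist (v 0) (v n) + cos K * dist (v n) (v (n + 1)) ≤ dist (v 0) (v (n + 1)) := by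
  cases n with
  | zero => simpa using mul_le_of_le_one_left dist_nonneg (cos_le_one K)
  | succ n =>
    obtain ⟨hx, hfan⟩ := hX.angle_add_fanAngle_le (fun i hi => hne i (by omega))
      ((totalRotation_mono (Nat.le_succ _) v).trans (hrot.trans hK))
    rw [totalRotation_add_two] at hrot
    exact hX.dist_add_le_of_angle_add_le (hne n (by omega)) hx (hne (n + 1) (by omega)).symm hK
      (by linarith [fanAngle_nonneg n v])

theorem IsCAT0.cos_mul_sum_dist_le (hX : IsCAT0 X) {v : ℕ → X} {K : ℝ} (hK : K ≤ π / 2) {n : ℕ}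
    (hne : ∀ i < n, v i ≠ v (i + 1)) (hrot : totalRotation n v ≤ K) :
    cos K * ∑ i ∈ Finset.range n, dist (v i) (v (i + 1)) ≤ dist (v 0) (v n) := by
  induction n with
  | zero => simp
  | succ n ih =>
    have ih' := ih (fun i hi => hne i (by omega))
      ((totalRotation_mono (Nat.le_succ n) v).trans hrot)
    rw [Finset.sum_range_succ, mul_add]
    linarith [hX.dist_add_le_of_totalRotation_le hK hne hrot]

theorem IsCAT0.dist_le_dist_of_totalRotation_le (hX : IsCAT0 X) {v : ℕ → X} {n : ℕ}
    (hne : ∀ i < n, v i ≠ v (i + 1)) (hrot : totalRotation n v ≤ π / 2) {j : ℕ} (hj : j ≤ n) :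
    dist (v 0) (v j) ≤ dist (v 0) (v n) := by
  induction n, hj using Nat.le_induction with
  | base => exact le_rfl
  | succ n _ ih =>
    have hgrowth := hX.dist_add_le_of_totalRotation_le le_rfl hne hrot
    rw [cos_pi_div_two, zero_mul, add_zero] at hgrowth
    exact (ih (fun i hi => hne i (by omega))
      ((totalRotation_mono (Nat.le_succ n) v).trans hrot)).trans hgrowth

theorem IsCAT0.dist_le_mul_modelAngle (hX : IsCAT0 X) {p q q' u v : X}
    (hu : u ∈ geodesicSegment p q) (hv : v ∈ geodesicSegment p q') (h : dist p u = dist p v) :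
    dist u v ≤ dist p u * modelAngle q p q' := by
  refine le_of_sq_le_sq (α := ℝ) ?_ (mul_nonneg dist_nonneg (modelAngle_nonneg _ _ _))
  calc dist u v ^ 2
      ≤ dist p u ^ 2 * (2 * (1 - cos (modelAngle q p q'))) :=
        (hX.dist_sq_le_modelAngle hu hv).trans_eq (by rw [← h]; ring)
    _ ≤ dist p u ^ 2 * modelAngle q p q' ^ 2 := by
        gcongr
        linarith [one_sub_sq_div_two_le_cos (x := modelAngle q p q')]
    _ = _ := (mul_pow _ _ 2).symm

theorem IsCAT0.dist_le_mul_fanAngle (hX : IsCAT0 X) {v : ℕ → X} {n j : ℕ} (hjn : j ≤ n)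
    (hmono : ∀ k ≤ n, j ≤ k → dist (v 0) (v (j + 1)) ≤ dist (v 0) (v (k + 1))) {x : X}
    (hx : x ∈ geodesicSegment (v 0) (v (n + 1))) (hdx : dist (v 0) x = dist (v 0) (v (j + 1))) :
    dist (v (j + 1)) x ≤ dist (v 0) (v (j + 1)) * fanAngle n v := by
  induction n, hjn using Nat.le_induction generalizing x with
  | base =>
    rw [hX.eq_of_mem_segment hx (hX.right_mem_segment _ _) hdx, dist_self]
    exact mul_nonneg dist_nonneg (fanAngle_nonneg j v)
  | succ n hn ih =>
    obtain ⟨u, hu, hdu⟩ := hX.exists_mem_segment ⟨dist_nonneg, hmono n (Nat.le_succ n) hn⟩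
    have hux := hX.dist_le_mul_modelAngle hu hx (hdu.trans hdx.symm)
    rw [hdu] at hux
    rw [fanAngle_succ, mul_add]
    linarith [dist_triangle (v (j + 1)) u x, ih (fun k hk => hmono k (by omega)) hu hdu]

theorem IsCAT0.dist_chord_le_of_totalRotation_le (hX : IsCAT0 X) {v : ℕ → X} {n : ℕ}
    (hne : ∀ i < n, v i ≠ v (i + 1)) (hrot : totalRotation n v ≤ π / 2) {j : ℕ} (hjn : j ≤ n)
    {x : X} (hx : x ∈ geodesicSegment (v 0) (v n)) (hdx : dist (v 0) x = dist (v 0) (v j)) :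
    dist (v j) x ≤ dist (v 0) (v j) * totalRotation n v := by
  rcases j with _ | j
  · rw [dist_self] at hdx ⊢
    rw [hdx, zero_mul]
  obtain ⟨n, rfl⟩ : ∃ k, n = k + 1 := ⟨n - 1, by omega⟩
  have hmono : ∀ k ≤ n, j ≤ k → dist (v 0) (v (j + 1)) ≤ dist (v 0) (v (k + 1)) := fun k hk hjk =>
    hX.dist_le_dist_of_totalRotation_le (fun i hi => hne i (by omega))
      ((totalRotation_mono (by omega) v).trans hrot) (by omega)
  calc dist (v (j + 1)) x ≤ dist (v 0) (v (j + 1)) * fanAngle n v :=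
        hX.dist_le_mul_fanAngle (by omega) hmono hx hdx
    _ ≤ dist (v 0) (v (j + 1)) * totalRotation (n + 1) v := by
        gcongr
        linarith [(hX.angle_add_fanAngle_le hne hrot).2, angle_nonneg (v n) (v (n + 1)) (v 0)]

end Metric

section Curve

variable {X : Type*} [MetricSpace X] {γ : ℝ → X} {a b c δ : ℝ} {n m : ℕ} {u w : ℕ → ℝ}

/-! ### Inscribed polygonal curves -/

/-- The parameters `a = u 0 < ⋯ < u n = b` define a polygonal curve inscribed in `γ` restricted to
`[a, b]` all of whose segments are nondegenerate and shorter than `δ`. -/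
structure IsFineInscribed (γ : ℝ → X) (a b δ : ℝ) (n : ℕ) (u : ℕ → ℝ) : Prop
    extends IsInscribed γ a b n u where
  dist_lt : ∀ i < n, dist (γ (u i)) (γ (u (i + 1))) < δ

/-- The length of the polygonal curve inscribed in `γ` with the parameters `u 0, …, u n`. -/
noncomputable def inscribedLength (γ : ℝ → X) (n : ℕ) (u : ℕ → ℝ) : ℝ :=
  ∑ i ∈ Finset.range n, dist (γ (u i)) (γ (u (i + 1)))

/-- The concatenation of the finite sequence `u 0, …, u n` with the sequence `w`; the term `w 0` is
dropped, as it is meant to coincide with `u n`. -/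
def glue {α : Type*} (n : ℕ) (u w : ℕ → α) (i : ℕ) : α := if i ≤ n then u i else w (i - n)

theorem glue_of_le {α : Type*} {i : ℕ} (u w : ℕ → α) (h : i ≤ n) : glue n u w i = u i := if_pos h

theorem glue_add {α : Type*} {u w : ℕ → α} (h : u n = w 0) (i : ℕ) : glue n u w (n + i) = w i := by
  cases i with
  | zero => rw [add_zero, glue_of_le u w le_rfl, h]
  | succ i => simp [glue]

theorem glue_forall {α : Type*} {u w : ℕ → α} {P : α → α → Prop} (h : u n = w 0)
    (hu : ∀ i < n, P (u i) (u (i + 1))) (hw : ∀ i < m, P (w i) (w (i + 1))) :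
    ∀ i < n + m, P (glue n u w i) (glue n u w (i + 1)) := by
  intro i hi
  rcases lt_or_ge i n with hin | hin
  · rw [glue_of_le _ _ hin.le, glue_of_le _ _ hin]
    exact hu i hin
  · obtain ⟨j, rfl⟩ := Nat.exists_eq_add_of_le hin
    rw [add_assoc, glue_add h, glue_add h]
    exact hw j (by omega)

theorem IsFineInscribed.glue (hu : IsFineInscribed γ a b δ n u)
    (hw : IsFineInscribed γ b c δ m w) : IsFineInscribed γ a c δ (n + m) (glue n u w) where
  first := by rw [glue_of_le _ _ (Nat.zero_le n), hu.first]
  last := by rw [glue_add (hu.last.trans hw.first.symm), hw.last]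
  lt_succ := glue_forall (P := (· < ·)) (hu.last.trans hw.first.symm) hu.lt_succ hw.lt_succ
  ne_succ := glue_forall (P := fun x y => γ x ≠ γ y) (hu.last.trans hw.first.symm)
    hu.ne_succ hw.ne_succ
  dist_lt := glue_forall (P := fun x y => dist (γ x) (γ y) < δ) (hu.last.trans hw.first.symm)
    hu.dist_lt hw.dist_lt

theorem inscribedLength_glue (h : u n = w 0) : inscribedLength γ (n + m) (glue n u w) =
    inscribedLength γ n u + inscribedLength γ m w := by
  unfold inscribedLength
  rw [Finset.sum_range_add]
  congr 1 <;> refine Finset.sum_congr rfl fun i hi => ?_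
  · rw [Finset.mem_range] at hi
    rw [glue_of_le _ _ hi.le, glue_of_le _ _ hi]
  · rw [add_assoc, glue_add h, glue_add h]

theorem totalRotation_add_le_glue {u w : ℕ → X} (h : u n = w 0) :
    totalRotation n u + totalRotation m w ≤ totalRotation (n + m) (glue n u w) := by
  have hu : totalRotation n u = totalRotation n (glue n u w) := by
    refine Finset.sum_congr rfl fun i hi => ?_
    rw [Finset.mem_range] at hi
    rw [glue_of_le _ _ (by omega), glue_of_le _ _ (by omega), glue_of_le _ _ (by omega)]
  cases m with
  | zero => exact (add_eq_left.2 (by simp [totalRotation])).le.trans hu.le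
  | succ m =>
    have hsplit : totalRotation (n + (m + 1)) (glue n u w) =
        totalRotation (n + 1) (glue n u w) + totalRotation (m + 1) w := by
      refine (Finset.sum_range_add _ n m).trans (congrArg _ (Finset.sum_congr rfl fun i _ => ?_))
      rw [add_assoc, add_assoc, glue_add h, glue_add h, glue_add h]
    rw [hsplit, hu]
    gcongr
    exact totalRotation_mono (Nat.le_succ n) _

theorem comp_glue {α β : Type*} (f : α → β) (n : ℕ) (u w : ℕ → α) (i : ℕ) :
    f (glue n u w i) = glue n (f ∘ u) (f ∘ w) i :=
  apply_ite f _ _ _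

theorem isFineInscribed_single (hab : a < b) (hne : γ a ≠ γ b) (hδ : dist (γ a) (γ b) < δ) :
    IsFineInscribed γ a b δ 1 (fun i => if i = 0 then a else b) :=
  ⟨⟨rfl, rfl, by simpa using hab, by simpa using hne⟩, by simpa using hδ⟩

theorem inscribedLength_single (γ : ℝ → X) (a b : ℝ) :
    inscribedLength γ 1 (fun i => if i = 0 then a else b) = dist (γ a) (γ b) := by
  simp [inscribedLength]

theorem inscribedLength_succ (γ : ℝ → X) (n : ℕ) (u : ℕ → ℝ) : inscribedLength γ (n + 1) u =
    inscribedLength γ n u + dist (γ (u n)) (γ (u (n + 1))) :=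
  Finset.sum_range_succ _ n

theorem exists_isFineInscribed_of_monotone (hw : Monotone w) {n : ℕ}
    (hδ : ∀ i < n, dist (γ (w i)) (γ (w (i + 1))) < δ) :
    inscribedLength γ n w = 0 ∨ ∃ m u, IsFineInscribed γ (w 0) (w n) δ m u ∧
      inscribedLength γ m u = inscribedLength γ n w := by
  -- For the induction the last parameter must be allowed to move within the fibre of `γ`, so that
  -- a degenerate last segment can be absorbed into the previous one.
  suffices h : ∀ t ≥ w n, γ t = γ (w n) → inscribedLength γ n w = 0 ∨
      ∃ m u, IsFineInscribed γ (w 0) t δ m u ∧ inscribedLength γ m u = inscribedLength γ n w from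
    h (w n) le_rfl rfl
  induction n with
  | zero => exact fun _ _ _ => Or.inl (by simp [inscribedLength])
  | succ n ih =>
    intro t ht hγt
    have hle : w n ≤ t := (hw n.le_succ).trans ht
    have hdist : dist (γ (w n)) (γ t) < δ := hγt ▸ hδ n n.lt_succ_self
    rw [inscribedLength_succ, ← hγt]
    replace ih := ih fun i hi => hδ i (by omega)
    rcases eq_or_ne (γ t) (γ (w n)) with heq | hne
    · simpa [heq] using ih t hle heq
    have hlt : w n < t := hle.lt_of_ne fun h => hne (h ▸ rfl)
    right
    rcases ih (w n) le_rfl rfl with h0 | ⟨m, u, hu, hlen⟩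
    · have h0n : γ (w 0) = γ (w n) :=
        dist_le_zero.1 ((dist_le_range_sum_dist (γ ∘ w) n).trans_eq h0)
      refine ⟨1, _, isFineInscribed_single ((hw n.zero_le).trans_lt hlt) (h0n ▸ hne.symm)
        (h0n ▸ hdist), ?_⟩
      rw [inscribedLength_single, h0, zero_add, h0n]
    · have hsingle := isFineInscribed_single hlt hne.symm hdist
      refine ⟨m + 1, _, hu.glue hsingle, ?_⟩
      rw [inscribedLength_glue (hu.last.trans hsingle.first.symm), hlen, inscribedLength_single]

/-! ### Curves parametrized by arclength -/

theorem exists_partition_of_lt_eVariationOn {α E : Type*} [LinearOrder α] [PseudoEMetricSpace E]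
    {f : α → E} {a b : α} {L : ℝ≥0∞} (hL : L < eVariationOn f (Icc a b)) :
    ∃ (n : ℕ) (w : ℕ → α), Monotone w ∧ w 0 = a ∧ w n = b ∧
      L < ∑ i ∈ Finset.range n, edist (f (w i)) (f (w (i + 1))) := by
  obtain ⟨⟨n, v, hv, hvm⟩, hsum⟩ := lt_iSup_iff.1 hL
  refine ⟨n + 2, fun | 0 => a | i + 1 => if i ≤ n then v i else b, ?_, rfl, by simp, ?_⟩
  · refine monotone_nat_of_le_succ fun i => ?_
    rcases i with _ | i
    · simpa using (hvm 0).1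
    · dsimp only
      split_ifs
      · exact hv i.le_succ
      · exact (hvm i).2
      · omega
      · exact le_rfl
  · rw [Finset.sum_range_succ, Finset.sum_range_succ']
    refine hsum.trans_le (le_add_right (le_add_right (Finset.sum_le_sum fun i hi => ?_)))
    rw [Finset.mem_range] at hi
    dsimp only
    rw [if_pos (by omega), if_pos (by omega), edist_comm]

variable {s : Set ℝ} [s.OrdConnected]

theorem eVariationOn_Icc_of_hasUnitSpeedOn (hγ : HasUnitSpeedOn γ s) (ha : a ∈ s) (hb : b ∈ s) :
    eVariationOn γ (Icc a b) = ENNReal.ofReal (b - a) := by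
  have h := hγ ha hb
  rwa [inter_eq_right.2 (Set.Icc_subset s ha hb), NNReal.coe_one, one_mul] at h

theorem dist_le_of_hasUnitSpeedOn (hγ : HasUnitSpeedOn γ s) (ha : a ∈ s) (hb : b ∈ s)
    (hab : a ≤ b) : dist (γ a) (γ b) ≤ b - a := by
  rw [← ENNReal.ofReal_le_ofReal_iff (sub_nonneg.2 hab), ← edist_dist,
    ← eVariationOn_Icc_of_hasUnitSpeedOn hγ ha hb]
  exact eVariationOn.edist_le γ (left_mem_Icc.2 hab) (right_mem_Icc.2 hab)

theorem exists_isFineInscribed_of_sub_lt (hγ : HasUnitSpeedOn γ s) (ha : a ∈ s) (hb : b ∈ s)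
    (hab : a < b) (hδ : b - a < δ) {ε : ℝ} (hε : 0 < ε) :
    ∃ n u, IsFineInscribed γ a b δ n u ∧ b - a - ε ≤ inscribedLength γ n u := by
  obtain ⟨L, hL, hLε⟩ : ∃ L ∈ Ico 0 (b - a), b - a - ε ≤ L :=
    ⟨max 0 (b - a - ε), ⟨le_max_left _ _, max_lt (by linarith) (by linarith)⟩, le_max_right _ _⟩
  have hLvar : ENNReal.ofReal L < eVariationOn γ (Icc a b) := by
    rw [eVariationOn_Icc_of_hasUnitSpeedOn hγ ha hb]
    exact (ENNReal.ofReal_lt_ofReal_iff (sub_pos.2 hab)).2 hL.2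
  obtain ⟨n, w, hw, rfl, rfl, hsum⟩ := exists_partition_of_lt_eVariationOn hLvar
  simp only [edist_dist] at hsum
  rw [← ENNReal.ofReal_sum_of_nonneg fun _ _ => dist_nonneg,
    ENNReal.ofReal_lt_ofReal_iff_of_nonneg hL.1] at hsum
  have hws : ∀ i ≤ n, w i ∈ s := fun i hi => Set.Icc_subset s ha hb ⟨hw i.zero_le, hw hi⟩
  have hfine : ∀ i < n, dist (γ (w i)) (γ (w (i + 1))) < δ := fun i hi =>
    (dist_le_of_hasUnitSpeedOn hγ (hws i hi.le) (hws (i + 1) hi) (hw i.le_succ)).trans_lt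
      (by linarith [hw i.zero_le, hw (Nat.succ_le_of_lt hi)])
  rcases exists_isFineInscribed_of_monotone hw hfine with h0 | ⟨m, u, hu, hlen⟩
  · exact absurd (hL.1.trans_lt hsum) h0.not_gt
  · exact ⟨m, u, hu, hLε.trans (hsum.le.trans_eq hlen.symm)⟩

theorem exists_isFineInscribed (hγ : HasUnitSpeedOn γ s) (ha : a ∈ s) (hb : b ∈ s) (hab : a < b)
    (hδ : 0 < δ) {ε : ℝ} (hε : 0 < ε) :
    ∃ n u, IsFineInscribed γ a b δ n u ∧ b - a - ε ≤ inscribedLength γ n u := by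
  obtain ⟨k, hk⟩ := pow_unbounded_of_one_lt ((b - a) / δ) one_lt_two
  rw [div_lt_iff₀ hδ] at hk
  induction k generalizing a b ε with
  | zero => exact exists_isFineInscribed_of_sub_lt hγ ha hb hab (by linarith) hε
  | succ k ih =>
    obtain ⟨mid, hmid⟩ : ∃ mid, mid = (a + b) / 2 := ⟨_, rfl⟩
    have hmids : mid ∈ s := Set.Icc_subset s ha hb ⟨by linarith, by linarith⟩
    rw [pow_succ] at hk
    obtain ⟨n, u, hu, hul⟩ := ih ha hmids (by linarith) (half_pos hε) (by linarith)
    obtain ⟨m, w, hw, hwl⟩ := ih hmids hb (by linarith) (half_pos hε) (by linarith)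
    refine ⟨n + m, _, hu.glue hw, ?_⟩
    rw [inscribedLength_glue (hu.last.trans hw.first.symm)]
    linarith

/-! ### Total curvature -/

/-- The supremum, over the inscribed polygonal curves with segments shorter than `δ`, of the total
rotation; its limit as `δ → 0` is the total curvature. -/
noncomputable def fineRotation (γ : ℝ → X) (a b δ : ℝ) : ℝ≥0∞ :=
  ⨆ (P : ℕ × (ℕ → ℝ)) (_ : IsFineInscribed γ a b δ P.1 P.2),
    ENNReal.ofReal (totalRotation P.1 fun i => γ (P.2 i))

theorem IsFineInscribed.totalRotation_le (hu : IsFineInscribed γ a b δ n u) :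
    ENNReal.ofReal (totalRotation n fun i => γ (u i)) ≤ fineRotation γ a b δ :=
  le_iSup₂_of_le (f := fun (P : ℕ × (ℕ → ℝ)) (_ : IsFineInscribed γ a b δ P.1 P.2) =>
    ENNReal.ofReal (totalRotation P.1 fun i => γ (P.2 i))) (n, u) hu le_rfl

theorem totalCurvature_eq_iInf_fineRotation (γ : ℝ → X) (a b : ℝ) :
    totalCurvature γ a b = ⨅ (δ : ℝ) (_ : 0 < δ), fineRotation γ a b δ := by
  have hfine : ∀ δ n u, IsFineInscribed γ a b δ n u ↔
      IsInscribed γ a b n u ∧ ∀ i < n, dist (γ (u i)) (γ (u (i + 1))) < δ :=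
    fun δ n u => ⟨fun h => ⟨h.1, h.2⟩, fun h => ⟨h.1, h.2⟩⟩
  simp only [totalCurvature, fineRotation, iSup_prod, hfine, iSup_and]

theorem totalCurvature_add_le (hγ : HasUnitSpeedOn γ s) (ha : a ∈ s) (hc : c ∈ s) (hab : a < b)
    (hbc : b < c) : totalCurvature γ a b + totalCurvature γ b c ≤ totalCurvature γ a c := by
  have hb : b ∈ s := Set.Icc_subset s ha hc ⟨hab.le, hbc.le⟩
  simp only [totalCurvature_eq_iInf_fineRotation]
  refine le_iInf₂ fun δ hδ => (add_le_add (iInf₂_le δ hδ) (iInf₂_le δ hδ)).trans ?_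
  obtain ⟨n₀, u₀, hu₀, -⟩ := exists_isFineInscribed hγ ha hb hab hδ one_pos
  obtain ⟨m₀, w₀, hw₀, -⟩ := exists_isFineInscribed hγ hb hc hbc hδ one_pos
  refine ENNReal.biSup_add_biSup_le' ⟨(n₀, u₀), hu₀⟩ ⟨(m₀, w₀), hw₀⟩ fun ⟨n, u⟩ hu ⟨m, w⟩ hw => ?_
  refine le_trans ?_ (hu.glue hw).totalRotation_le
  rw [← ENNReal.ofReal_add (totalRotation_nonneg _ _) (totalRotation_nonneg _ _)]
  simp only [comp_glue γ]
  exact ENNReal.ofReal_le_ofReal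
    (totalRotation_add_le_glue (congrArg γ (hu.last.trans hw.first.symm)))

theorem exists_totalRotation_le {K : ℝ} (h : totalCurvature γ a b < ENNReal.ofReal K) :
    ∃ δ > 0, ∀ n u, IsFineInscribed γ a b δ n u → totalRotation n (fun i => γ (u i)) ≤ K := by
  rw [totalCurvature_eq_iInf_fineRotation] at h
  simp only [iInf_lt_iff] at h
  obtain ⟨δ, hδ, hlt⟩ := h
  have hK : 0 ≤ K := (ENNReal.ofReal_pos.1 (bot_le.trans_lt hlt)).le
  exact ⟨δ, hδ, fun n u hu =>
    (ENNReal.ofReal_le_ofReal_iff hK).1 (hu.totalRotation_le.trans hlt.le)⟩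

theorem IsCAT0.cos_mul_le_dist (hX : IsCAT0 X) (hγ : HasUnitSpeedOn γ s) (ha : a ∈ s) (hb : b ∈ s)
    (hab : a ≤ b) {K : ℝ} (hK : K ≤ π / 2) (h : totalCurvature γ a b < ENNReal.ofReal K) :
    cos K * (b - a) ≤ dist (γ a) (γ b) := by
  rcases hab.eq_or_lt with rfl | hab
  · simp
  have hK0 : 0 < K := ENNReal.ofReal_pos.1 (bot_le.trans_lt h)
  have hcos : 0 ≤ cos K := cos_nonneg_of_mem_Icc ⟨by linarith, hK⟩
  obtain ⟨δ, hδ, hrot⟩ := exists_totalRotation_le h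
  refine le_of_forall_pos_le_add fun ε hε => ?_
  obtain ⟨n, u, hu, hlen⟩ := exists_isFineInscribed hγ ha hb hab hδ hε
  have hchord := hX.cos_mul_sum_dist_le hK hu.ne_succ (hrot n u hu)
  rw [hu.first, hu.last] at hchord
  calc cos K * (b - a) = cos K * (b - a - ε) + cos K * ε := by ring
    _ ≤ cos K * inscribedLength γ n u + 1 * ε := by gcongr; exact cos_le_one K
    _ ≤ dist (γ a) (γ b) + ε := by rw [one_mul]; gcongr; exact hchord

theorem IsCAT0.dist_chord_le (hX : IsCAT0 X) (hγ : HasUnitSpeedOn γ s) (ha : a ∈ s) (hc : c ∈ s)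
    (hab : a < b) (hbc : b < c) {K : ℝ} (hK : K ≤ π / 2)
    (h : totalCurvature γ a c < ENNReal.ofReal K) :
    dist (γ a) (γ b) ≤ dist (γ a) (γ c) ∧ ∀ x ∈ geodesicSegment (γ a) (γ c),
      dist (γ a) x = dist (γ a) (γ b) → dist (γ b) x ≤ dist (γ a) (γ b) * K := by
  have hb : b ∈ s := Set.Icc_subset s ha hc ⟨hab.le, hbc.le⟩
  obtain ⟨δ, hδ, hrot⟩ := exists_totalRotation_le h
  obtain ⟨n, u, hu, -⟩ := exists_isFineInscribed hγ ha hb hab hδ one_pos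
  obtain ⟨m, w, hw, -⟩ := exists_isFineInscribed hγ hb hc hbc hδ one_pos
  have hg := hu.glue hw
  have hrotK := hrot _ _ hg
  have hdist := hX.dist_le_dist_of_totalRotation_le hg.ne_succ (hrotK.trans hK)
    (Nat.le_add_right n m)
  have hchord := fun x => hX.dist_chord_le_of_totalRotation_le hg.ne_succ (hrotK.trans hK)
    (Nat.le_add_right n m) (x := x)
  simp only [hg.first, hg.last, glue_of_le u w le_rfl, hu.last] at hdist hchord
  exact ⟨hdist, fun x hx hdx => (hchord x hx hdx).trans (by gcongr)⟩

end Curve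

section FiniteTotalCurvature

variable {X : Type*} [MetricSpace X] {γ σ : ℝ → X} {τγ : ℝ≥0}

/-! ### Curves of finite total curvature -/

theorem monotoneOn_totalCurvature (hγ : HasUnitSpeedOn γ (Ici 0)) :
    MonotoneOn (totalCurvature γ 0) (Ioi 0) := by
  intro s hs t ht hst
  rcases hst.eq_or_lt with rfl | hst
  · exact le_rfl
  · exact le_self_add.trans (totalCurvature_add_le hγ self_mem_Ici (mem_Ici_of_Ioi ht) hs hst)

theorem totalCurvature_le_sub (hγ : HasUnitSpeedOn γ (Ici 0))
    (hτ : Tendsto (totalCurvature γ 0) atTop (𝓝 (τγ : ℝ≥0∞))) {s t : ℝ} (hs : 0 < s)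
    (hst : s < t) : totalCurvature γ s t ≤ τγ - totalCurvature γ 0 s := by
  have ht : 0 < t := hs.trans hst
  have hle : totalCurvature γ 0 t ≤ τγ := ge_of_tendsto hτ <|
    (eventually_ge_atTop t).mono fun t' ht' =>
      monotoneOn_totalCurvature hγ ht (ht.trans_le ht') ht'
  have hadd := (totalCurvature_add_le hγ self_mem_Ici ht.le hs hst).trans hle
  exact ENNReal.le_sub_of_add_le_left
    (ne_top_of_le_ne_top ENNReal.coe_ne_top (le_self_add.trans hadd)) hadd

/-- The final arcs of `γ` have arbitrarily small total curvature. This is the form in which the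
finiteness of the total curvature enters parts (a) and (b). -/
def HasVanishingTailCurvature (γ : ℝ → X) : Prop :=
  ∀ K > 0, ∃ s > 0, ∀ t > s, totalCurvature γ s t < ENNReal.ofReal K

theorem hasVanishingTailCurvature_of_tendsto (hγ : HasUnitSpeedOn γ (Ici 0))
    (hτ : Tendsto (totalCurvature γ 0) atTop (𝓝 (τγ : ℝ≥0∞))) : HasVanishingTailCurvature γ := by
  intro K hK
  have htail := ENNReal.Tendsto.sub (tendsto_const_nhds (x := (τγ : ℝ≥0∞))) hτ
    (Or.inl ENNReal.coe_ne_top)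
  rw [tsub_self] at htail
  obtain ⟨s, hsK, hs⟩ := ((htail.eventually_lt_const (ENNReal.ofReal_pos.2 hK)).and
    (eventually_gt_atTop 0)).exists
  exact ⟨s, hs, fun t ht => (totalCurvature_le_sub hγ hτ hs ht).trans_lt hsK⟩

theorem IsCAT0.isBigO_dist (hX : IsCAT0 X) (hγ : HasUnitSpeedOn γ (Ici 0))
    (hκ : HasVanishingTailCurvature γ) (p : X) :
    (fun t : ℝ => t) =O[atTop] fun t => dist p (γ t) := by
  obtain ⟨s, hs, hcurv⟩ := hκ 1 one_pos
  have hcos : 0 < cos 1 := cos_one_pos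
  refine Asymptotics.IsBigO.of_bound (2 / cos 1) ?_
  filter_upwards [eventually_gt_atTop s,
    eventually_ge_atTop (2 * (cos 1 * s + dist p (γ s)) / cos 1)] with t hst ht
  have ht0 : 0 ≤ t := (hs.trans hst).le
  have hchord := hX.cos_mul_le_dist hγ hs.le ht0 hst.le one_le_pi_div_two (hcurv t hst)
  rw [div_le_iff₀ hcos] at ht
  rw [norm_of_nonneg ht0, norm_of_nonneg dist_nonneg, div_mul_eq_mul_div, le_div_iff₀ hcos]
  linarith [dist_triangle_left (γ s) (γ t) p]

theorem IsCAT0.tendsto_dist (hX : IsCAT0 X) (hγ : HasUnitSpeedOn γ (Ici 0))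
    (hκ : HasVanishingTailCurvature γ) (p : X) : Tendsto (fun t => dist p (γ t)) atTop atTop := by
  obtain ⟨C, hC, hbound⟩ := (hX.isBigO_dist hγ hκ p).exists_pos
  refine tendsto_atTop_mono' atTop ?_ (tendsto_id.atTop_div_const hC)
  filter_upwards [hbound.bound] with t ht
  rw [norm_of_nonneg dist_nonneg] at ht
  exact (div_le_iff₀' hC).2 ((le_norm_self t).trans ht)

theorem dist_le_circumradius (hγ : HasUnitSpeedOn γ (Ici 0)) {t : ℝ} (ht : 0 ≤ t) :
    dist (γ 0) (γ t) ≤ circumradius γ t := by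
  refine le_csInf ⟨t, ?_⟩ fun r hr => Metric.mem_closedBall'.1 (hr ⟨t, ⟨ht, le_rfl⟩, rfl⟩)
  rintro _ ⟨s, hs, rfl⟩
  rw [Metric.mem_closedBall']
  linarith [dist_le_of_hasUnitSpeedOn hγ self_mem_Ici hs.1 hs.1, hs.2]

theorem IsCAT0.isBigO_circumradius (hX : IsCAT0 X) (hγ : HasUnitSpeedOn γ (Ici 0))
    (hκ : HasVanishingTailCurvature γ) : (fun t : ℝ => t) =O[atTop] circumradius γ := by
  refine (hX.isBigO_dist hγ hκ (γ 0)).trans (Asymptotics.IsBigO.of_bound' ?_)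
  filter_upwards [eventually_ge_atTop 0] with t ht
  rw [norm_of_nonneg dist_nonneg]
  exact (dist_le_circumradius hγ ht).trans (le_norm_self _)

/-! ### The asymptotic ray -/

/-- As `t → ∞`, all geodesics from `p` to later points of `γ` pass `γ t` at a distance which is
sublinear in `dist p (γ t)`. -/
def HasSublinearDeviation (p : X) (γ : ℝ → X) : Prop :=
  ∀ ε > 0, ∀ᶠ t in atTop, ∀ t' > t, ∀ x ∈ geodesicSegment p (γ t'),
    dist p x = dist p (γ t) → dist (γ t) x ≤ ε * dist p (γ t)

theorem IsCAT0.dist_segment_le (hX : IsCAT0 X) {p q r x y : X} (hy : y ∈ geodesicSegment q r)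
    (hx : x ∈ geodesicSegment p r) {z : X} (hxz : dist p x = dist p z) :
    dist z x ≤ 2 * (dist z y + dist p q) := by
  obtain ⟨l, hl, hql, -⟩ := dist_eq_mul_of_mem_segment hy
  obtain ⟨w, hw, hpw⟩ := hX.exists_mem_segment (x := p) (y := r) (s := l * dist p r)
    ⟨mul_nonneg hl.1 dist_nonneg, mul_le_of_le_one_left dist_nonneg hl.2⟩
  have hyw : dist y w ≤ dist p q := calc
    dist y w ≤ (1 - l) * dist q p + l * dist r r := hX.dist_le_convex hy hw hl hql hpw
    _ ≤ 1 * dist p q := by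
      rw [dist_self, mul_zero, add_zero, dist_comm q]
      gcongr
      linarith [hl.1]
    _ = dist p q := one_mul _
  have hwx : dist w x ≤ dist z w := calc
    dist w x ≤ |dist p w - dist p x| := hX.dist_le_abs_sub hw hx
    _ = |dist z p - dist w p| := by rw [hxz, dist_comm p, dist_comm p, abs_sub_comm]
    _ ≤ dist z w := abs_dist_sub_le z w p
  linarith [dist_triangle z w x, dist_triangle z y w]

theorem IsCAT0.dist_le_of_chord (hX : IsCAT0 X) (hγ : HasUnitSpeedOn γ (Ici 0)) (p : X)
    {s t t' K : ℝ} (hs : 0 ≤ s) (hst : s < t) (htt' : t < t') (hK : K ≤ π / 2)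
    (h : totalCurvature γ s t' < ENNReal.ofReal K) {x : X} (hx : x ∈ geodesicSegment p (γ t'))
    (hdx : dist p x = dist p (γ t)) :
    dist (γ t) x ≤ 2 * (dist (γ s) (γ t) * K + dist p (γ s)) := by
  obtain ⟨hle, hchord⟩ := hX.dist_chord_le hγ hs (hs.trans (hst.trans htt').le) hst htt' hK h
  obtain ⟨y, hy, hdy⟩ := hX.exists_mem_segment ⟨dist_nonneg, hle⟩
  linarith [hX.dist_segment_le hy hx hdx, hchord y hy hdy]

theorem IsCAT0.hasSublinearDeviation (hX : IsCAT0 X) (hγ : HasUnitSpeedOn γ (Ici 0))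
    (hκ : HasVanishingTailCurvature γ) (p : X) : HasSublinearDeviation p γ := by
  intro ε hε
  obtain ⟨K, hK0, hK1, hKε⟩ : ∃ K > 0, K ≤ 1 ∧ K ≤ ε / 4 :=
    ⟨min 1 (ε / 4), by positivity, min_le_left _ _, min_le_right _ _⟩
  obtain ⟨s, hs, hcurv⟩ := hκ K hK0
  filter_upwards [eventually_gt_atTop s, (hX.tendsto_dist hγ hκ p).eventually_ge_atTop
    (8 * dist p (γ s) / ε)] with t hst ht t' htt' x hx hdx
  rw [div_le_iff₀ hε] at ht
  have hdist : dist (γ s) (γ t) * K ≤ dist p (γ s) + dist p (γ t) * (ε / 4) := calc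
    dist (γ s) (γ t) * K ≤ (dist p (γ s) + dist p (γ t)) * K := by
      gcongr
      exact dist_triangle_left _ _ _
    _ = dist p (γ s) * K + dist p (γ t) * K := add_mul _ _ _
    _ ≤ dist p (γ s) * 1 + dist p (γ t) * (ε / 4) := by gcongr
    _ = _ := by rw [mul_one]
  linarith [hX.dist_le_of_chord hγ p hs.le hst htt' (hK1.trans one_le_pi_div_two)
    (hcurv t' (hst.trans htt')) hx hdx]

theorem exists_isGeodesicRay_of_cauchy [CompleteSpace X] {ι : Type*} {F : Filter ι}
    {G : ι → ℝ → X} {p : X} {q : ι → X} (hG : ∀ i, IsGeodesicFromTo (G i) p (q i))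
    (hq : Tendsto (fun i => dist p (q i)) F atTop)
    (hcauchy : ∀ R, 0 ≤ R → Cauchy (F.map fun i => G i R)) :
    ∃ σ : ℝ → X, IsGeodesicRay σ ∧ σ 0 = p ∧
      ∀ R, 0 ≤ R → Tendsto (fun i => G i R) F (𝓝 (σ R)) := by
  have : F.NeBot := map_neBot_iff _ |>.1 (hcauchy 0 le_rfl).1
  have : Nonempty X := ⟨p⟩
  choose! σ hσ using fun R hR => cauchy_map_iff_exists_tendsto.1 (hcauchy R hR)
  refine ⟨σ, fun s hs t ht => ?_, ?_, hσ⟩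
  · refine tendsto_nhds_unique ((hσ s hs).dist (hσ t ht)) (tendsto_const_nhds.congr' ?_)
    filter_upwards [hq.eventually_ge_atTop s, hq.eventually_ge_atTop t] with i hsi hti
    exact ((hG i).2.2 s ⟨hs, hsi⟩ t ⟨ht, hti⟩).symm
  · exact tendsto_nhds_unique (hσ 0 le_rfl) (tendsto_const_nhds.congr fun i => (hG i).1.symm)

theorem IsCAT0.dist_geodesic_le (hX : IsCAT0 X) {p q q' : X} {G G' : ℝ → X}
    (hG : IsGeodesicFromTo G p q) (hG' : IsGeodesicFromTo G' p q') (hle : dist p q ≤ dist p q')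
    {R : ℝ} (hR : R ∈ Icc 0 (dist p q)) :
    dist (G R) (G' R) ≤ R / dist p q * dist q (G' (dist p q)) := by
  have hq : dist p q ∈ Icc 0 (dist p q') := ⟨dist_nonneg, hle⟩
  have hR' : R ∈ Icc 0 (dist p q') := ⟨hR.1, hR.2.trans hle⟩
  have hscale : R = R / dist p q * dist p q :=
    (div_mul_cancel_of_imp fun h => le_antisymm (hR.2.trans_eq h) hR.1).symm
  have hd := hG'.dist_left hq
  refine hX.dist_le_mul (hG.mem_geodesicSegment hR)
    ((hG'.restrict hq).mem_geodesicSegment (by rwa [hd])) (div_nonneg hR.1 dist_nonneg) ?_ ?_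
  · rw [hG.dist_left hR, ← hscale]
  · rw [hG'.dist_left hR', hd, ← hscale]

section Deviation

variable {p : X} {G : ℝ → ℝ → X}

theorem IsCAT0.cauchySeq_geodesic (hX : IsCAT0 X) (hG : ∀ t, IsGeodesicFromTo (G t) p (γ t))
    (hdist : Tendsto (fun t => dist p (γ t)) atTop atTop) (hdev : HasSublinearDeviation p γ) {R : ℝ}
    (hR : 0 ≤ R) : CauchySeq fun t => G t R := by
  refine Metric.cauchySeq_iff'.2 fun ε hε => ?_
  obtain ⟨δ, hδ, hRδ⟩ := exists_pos_mul_lt (half_pos hε) R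
  obtain ⟨t, hdev, hRt, ht⟩ := ((hdev δ hδ).and
    ((hdist.eventually_ge_atTop R).and (hdist.eventually_gt_atTop 0))).exists
  have hclose : ∀ᶠ t' in atTop, dist (G t' R) (G t R) < ε / 2 := by
    filter_upwards [hdist.eventually_ge_atTop (dist p (γ t)), eventually_gt_atTop t]
      with t' hle htt'
    have hmem : dist p (γ t) ∈ Icc 0 (dist p (γ t')) := ⟨dist_nonneg, hle⟩
    calc dist (G t' R) (G t R)
        ≤ R / dist p (γ t) * dist (γ t) (G t' (dist p (γ t))) := by
          rw [dist_comm]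
          exact hX.dist_geodesic_le (hG t) (hG t') hle ⟨hR, hRt⟩
      _ ≤ R / dist p (γ t) * (δ * dist p (γ t)) := by
          gcongr
          exact hdev t' htt' _ ((hG t').mem_geodesicSegment hmem) ((hG t').dist_left hmem)
      _ = R * δ := by field_simp
      _ < ε / 2 := hRδ
  obtain ⟨N, hN⟩ := eventually_atTop.1 hclose
  refine ⟨N, fun n hn => ?_⟩
  linarith [dist_triangle_right (G n R) (G N R) (G t R), hN n hn, hN N le_rfl]

theorem HasSublinearDeviation.isLittleO_distToRay (hdev : HasSublinearDeviation p γ)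
    (hG : ∀ t, IsGeodesicFromTo (G t) p (γ t))
    (hdist : Tendsto (fun t => dist p (γ t)) atTop atTop)
    (hσ : ∀ R, 0 ≤ R → Tendsto (fun t => G t R) atTop (𝓝 (σ R))) :
    (fun t => distToRay (γ t) σ) =o[atTop] fun t => dist p (γ t) := by
  refine Asymptotics.isLittleO_iff.2 fun ε hε => ?_
  filter_upwards [hdev ε hε] with t ht
  rw [distToRay, norm_of_nonneg Metric.infDist_nonneg, norm_of_nonneg dist_nonneg]
  calc Metric.infDist (γ t) (σ '' Ici 0) ≤ dist (γ t) (σ (dist p (γ t))) :=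
        Metric.infDist_le_dist_of_mem (mem_image_of_mem σ dist_nonneg)
    _ ≤ ε * dist p (γ t) := by
        refine le_of_tendsto (tendsto_const_nhds.dist (hσ _ dist_nonneg)) ?_
        filter_upwards [hdist.eventually_ge_atTop (dist p (γ t)), eventually_gt_atTop t]
          with t' hle htt'
        have hmem : dist p (γ t) ∈ Icc 0 (dist p (γ t')) := ⟨dist_nonneg, hle⟩
        exact ht t' htt' _ ((hG t').mem_geodesicSegment hmem) ((hG t').dist_left hmem)

end Deviation

theorem dist_isBigO (hγ : HasUnitSpeedOn γ (Ici 0)) (p : X) :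
    (fun t => dist p (γ t)) =O[atTop] fun t : ℝ => t := by
  refine Asymptotics.IsBigO.of_bound 2 ?_
  filter_upwards [eventually_ge_atTop 0, eventually_ge_atTop (dist p (γ 0))] with t ht hpt
  rw [norm_of_nonneg ht, norm_of_nonneg dist_nonneg]
  linarith [dist_triangle p (γ 0) (γ t), dist_le_of_hasUnitSpeedOn hγ self_mem_Ici ht ht]

theorem IsCAT0.exists_isGeodesicRay [CompleteSpace X] (hX : IsCAT0 X)
    (hγ : HasUnitSpeedOn γ (Ici 0)) (hκ : HasVanishingTailCurvature γ) (p : X) :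
    ∃ σ : ℝ → X, IsGeodesicRay σ ∧ σ 0 = p ∧
      (fun t : ℝ => distToRay (γ t) σ) =o[atTop] (fun t : ℝ => t) := by
  choose G hG using fun t : ℝ => hX.exists_geodesic p (γ t)
  have hdist := hX.tendsto_dist hγ hκ p
  have hdev := hX.hasSublinearDeviation hγ hκ p
  obtain ⟨σ, hσ, hσ0, hlim⟩ := exists_isGeodesicRay_of_cauchy hG hdist
    fun R hR => hX.cauchySeq_geodesic hG hdist hdev hR
  exact ⟨σ, hσ, hσ0, (hdev.isLittleO_distToRay hG hdist hlim).trans_isBigO (dist_isBigO hγ p)⟩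

/-! ### Geodesically convex sets -/

/-- A set is geodesically convex if it contains every geodesic between two of its points. -/
def IsGeodesicallyConvex (S : Set X) : Prop :=
  ∀ x ∈ S, ∀ y ∈ S, geodesicSegment x y ⊆ S

theorem IsCAT0.isGeodesicallyConvex_ray (hX : IsCAT0 X) (hσ : IsGeodesicRay σ) :
    IsGeodesicallyConvex (σ '' Ici 0) := by
  rintro _ ⟨i, hi, rfl⟩ _ ⟨j, hj, rfl⟩ z hz
  wlog hij : i ≤ j generalizing i j
  · exact this j hj i hi (geodesicSegment_comm (σ i) (σ j) ▸ hz) (le_of_not_ge hij)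
  have hd : dist (σ i) (σ j) = j - i := by
    rw [hσ i hi j hj, abs_sub_comm, abs_of_nonneg (sub_nonneg.2 hij)]
  have hgeo : IsGeodesicFromTo (fun t => σ (i + t)) (σ i) (σ j) := by
    refine ⟨by simp, by simp [hd], fun s hs t ht => ?_⟩
    rw [hσ _ (add_nonneg hi hs.1) _ (add_nonneg hi ht.1), add_sub_add_left_eq_sub]
  have hmem : dist (σ i) z ∈ Icc 0 (dist (σ i) (σ j)) := ⟨dist_nonneg, dist_le_of_mem_segment hz⟩
  rw [hX.eq_of_mem_segment hz (hgeo.mem_geodesicSegment hmem) (hgeo.dist_left hmem).symm]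
  exact mem_image_of_mem σ (add_nonneg hi dist_nonneg)

variable {S : Set X}

theorem IsCAT0.infDist_le_convex (hX : IsCAT0 X) (hS : IsGeodesicallyConvex S) (hne : S.Nonempty)
    {q q' x : X} (hx : x ∈ geodesicSegment q q') {l : ℝ} (hl : l ∈ Icc (0 : ℝ) 1)
    (hqx : dist q x = l * dist q q') :
    Metric.infDist x S ≤ (1 - l) * Metric.infDist q S + l * Metric.infDist q' S := by
  refine le_of_forall_pos_le_add fun ε hε => ?_
  obtain ⟨y, hy, hqy⟩ := (Metric.infDist_lt_iff (x := q) hne).1 (lt_add_of_pos_right _ hε)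
  obtain ⟨y', hy', hqy'⟩ := (Metric.infDist_lt_iff (x := q') hne).1 (lt_add_of_pos_right _ hε)
  obtain ⟨z, hz, hyz⟩ := hX.exists_mem_segment (x := y) (y := y') (s := l * dist y y')
    ⟨mul_nonneg hl.1 dist_nonneg, mul_le_of_le_one_left dist_nonneg hl.2⟩
  have hl' : 0 ≤ 1 - l := sub_nonneg.2 hl.2
  calc Metric.infDist x S ≤ dist x z := Metric.infDist_le_dist_of_mem (hS y hy y' hy' hz)
    _ ≤ (1 - l) * dist q y + l * dist q' y' := hX.dist_le_convex hx hz hl hqx hyz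
    _ ≤ (1 - l) * (Metric.infDist q S + ε) + l * (Metric.infDist q' S + ε) := by
        gcongr
        exact hl.1
    _ = _ := by ring

theorem IsCAT0.infDist_le_of_totalCurvature_lt (hX : IsCAT0 X) (hγ : HasUnitSpeedOn γ (Ici 0))
    (hS : IsGeodesicallyConvex S) (hne : S.Nonempty) {s s' K : ℝ} (hs : 0 ≤ s) (hss' : s < s')
    (ho : (fun t => Metric.infDist (γ t) S) =o[atTop] fun t => dist (γ s) (γ t))
    (hK : K ≤ π / 2) (hcurv : ∀ t > s, totalCurvature γ s t < ENNReal.ofReal K) :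
    Metric.infDist (γ s') S ≤ Metric.infDist (γ s) S + (s' - s) * K := by
  have hK0 : 0 < K := ENNReal.ofReal_pos.1 (bot_le.trans_lt (hcurv s' hss'))
  refine le_of_forall_pos_le_add fun e he => ?_
  obtain ⟨ε, hε, hlt⟩ := exists_pos_mul_lt he (dist (γ s) (γ s'))
  obtain ⟨t, ht, hεt⟩ := ((eventually_gt_atTop s').and (ho.def hε)).exists
  rw [norm_of_nonneg Metric.infDist_nonneg, norm_of_nonneg dist_nonneg] at hεt
  obtain ⟨hle, hchord⟩ := hX.dist_chord_le hγ hs (hs.trans (hss'.trans ht).le) hss' ht hK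
    (hcurv t (hss'.trans ht))
  obtain ⟨x, hx, hdx⟩ := hX.exists_mem_segment ⟨dist_nonneg, hle⟩
  obtain ⟨l, hl, hlx, -⟩ := dist_eq_mul_of_mem_segment hx
  have hl' : 1 - l ≤ 1 := by linarith [hl.1]
  calc Metric.infDist (γ s') S ≤ Metric.infDist x S + dist (γ s') x :=
        Metric.infDist_le_infDist_add_dist
    _ ≤ (1 - l) * Metric.infDist (γ s) S + l * Metric.infDist (γ t) S
          + dist (γ s) (γ s') * K :=
        add_le_add (hX.infDist_le_convex hS hne hx hl hlx) (hchord x hx hdx)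
    _ ≤ 1 * Metric.infDist (γ s) S + l * (ε * dist (γ s) (γ t)) + (s' - s) * K := by
        gcongr
        exacts [Metric.infDist_nonneg, hl.1,
          dist_le_of_hasUnitSpeedOn hγ hs (hs.trans hss'.le) hss'.le]
    _ = Metric.infDist (γ s) S + (s' - s) * K + dist (γ s) (γ s') * ε := by
        rw [← hdx, hlx]
        ring
    _ ≤ Metric.infDist (γ s) S + (s' - s) * K + e := by gcongr

/-! ### Curves with integrable remaining curvature -/

theorem tsum_le_setLIntegral_of_antitoneOn {f : ℝ → ℝ≥0∞} (hf : AntitoneOn f (Ioi 0)) :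
    ∑' n : ℕ, f (n + 1) ≤ ∫⁻ t in Ioi 0, f t := by
  have hpos : ∀ (n : ℕ), ∀ t ∈ Ioc (n : ℝ) (n + 1), t ∈ Ioi (0 : ℝ) :=
    fun n t ht => n.cast_nonneg.trans_lt ht.1
  have hdisj : Pairwise (Function.onFun Disjoint fun n : ℕ => Ioc (n : ℝ) (n + 1)) := by
    intro m n hmn
    simpa only [Function.onFun, Int.cast_natCast] using
      pairwise_disjoint_Ioc_intCast ℝ (Nat.cast_injective.ne hmn : (m : ℤ) ≠ n)
  calc ∑' n : ℕ, f (n + 1) ≤ ∑' n : ℕ, ∫⁻ t in Ioc (n : ℝ) (n + 1), f t := by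
        refine ENNReal.tsum_le_tsum fun n => ?_
        calc f (n + 1) = ∫⁻ _ in Ioc (n : ℝ) (n + 1), f (n + 1) := by simp
          _ ≤ _ := MeasureTheory.setLIntegral_mono' measurableSet_Ioc fun t ht =>
            hf (hpos n t ht) (mem_Ioi.2 n.cast_add_one_pos) ht.2
    _ = ∫⁻ t in ⋃ n : ℕ, Ioc (n : ℝ) (n + 1), f t :=
        (MeasureTheory.lintegral_iUnion (fun _ => measurableSet_Ioc) hdisj f).symm
    _ ≤ ∫⁻ t in Ioi 0, f t := MeasureTheory.lintegral_mono_set (iUnion_subset hpos)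

theorem summable_sub_totalCurvature (hγ : HasUnitSpeedOn γ (Ici 0))
    (hint : (∫⁻ t in Ici (0 : ℝ), ((τγ : ℝ≥0∞) - totalCurvature γ 0 t)) < ∞) :
    Summable fun n : ℕ => ((τγ : ℝ≥0∞) - totalCurvature γ 0 n).toReal := by
  have hanti : AntitoneOn (fun t => (τγ : ℝ≥0∞) - totalCurvature γ 0 t) (Ioi 0) :=
    fun s hs t ht hst => tsub_le_tsub_left (monotoneOn_totalCurvature hγ hs ht hst) _
  rw [← summable_nat_add_iff 1]
  refine ENNReal.summable_toReal (ne_top_of_le_ne_top hint.ne ?_)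
  simpa only [Nat.cast_add_one] using (tsum_le_setLIntegral_of_antitoneOn hanti).trans
    (MeasureTheory.lintegral_mono_set Ioi_subset_Ici_self)

theorem bddAbove_range_of_le_add_summable {f κ : ℕ → ℝ} (hκ : Summable κ)
    (hf : ∀ᶠ n in atTop, f (n + 1) ≤ f n + κ n) : BddAbove (range f) := by
  obtain ⟨N, hN⟩ := eventually_atTop.1 hf
  obtain ⟨B, hB⟩ := hκ.hasSum.tendsto_sum_nat.bddAbove_range
  have hle : ∀ n ≥ N, f n ≤ f N - ∑ i ∈ Finset.range N, κ i + ∑ i ∈ Finset.range n, κ i := by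
    intro n hn
    induction n, hn using Nat.le_induction with
    | base => rw [sub_add_cancel]
    | succ n hn ih =>
      rw [Finset.sum_range_succ]
      linarith [hN n hn]
  refine IsBoundedUnder.bddAbove_range ⟨f N - ∑ i ∈ Finset.range N, κ i + B, ?_⟩
  rw [eventually_map]
  filter_upwards [eventually_ge_atTop N] with n hn
  exact (hle n hn).trans (add_le_add_right (hB (mem_range_self n)) _)

theorem IsCAT0.bddAbove_distToRay_natCast (hX : IsCAT0 X) (hγ : HasUnitSpeedOn γ (Ici 0))
    (hτ : Tendsto (totalCurvature γ 0) atTop (𝓝 (τγ : ℝ≥0∞)))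
    (hint : (∫⁻ t in Ici (0 : ℝ), ((τγ : ℝ≥0∞) - totalCurvature γ 0 t)) < ∞)
    (hσ : IsGeodesicRay σ) (ho : (fun t : ℝ => distToRay (γ t) σ) =o[atTop] (fun t : ℝ => t)) :
    BddAbove (range fun n : ℕ => distToRay (γ n) σ) := by
  -- The geometric term makes the bound on the remaining curvature strict.
  have hsum := (summable_sub_totalCurvature hγ hint).add summable_geometric_two
  refine bddAbove_range_of_le_add_summable hsum ?_
  filter_upwards [hsum.tendsto_atTop_zero.eventually_le_const pi_div_two_pos,
    eventually_gt_atTop 0] with n hK hn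
  have hκ := hasVanishingTailCurvature_of_tendsto hγ hτ
  have htail : ∀ t > (n : ℝ), totalCurvature γ n t <
      ENNReal.ofReal ((τγ - totalCurvature γ 0 n : ℝ≥0∞).toReal + (1 / 2) ^ n) := fun t ht =>
    (totalCurvature_le_sub hγ hτ (Nat.cast_pos.2 hn) ht).trans_lt <|
      (ENNReal.lt_ofReal_iff_toReal_lt (ne_top_of_le_ne_top ENNReal.coe_ne_top tsub_le_self)).2
        (lt_add_of_pos_right _ (by positivity))
  have hstep := hX.infDist_le_of_totalCurvature_lt hγ (hX.isGeodesicallyConvex_ray hσ)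
    (nonempty_Ici.image σ) n.cast_nonneg (lt_add_one (n : ℝ))
    (ho.trans_isBigO (hX.isBigO_dist hγ hκ (γ n))) hK htail
  rwa [add_sub_cancel_left, one_mul, ← Nat.cast_add_one] at hstep

theorem IsCAT0.isAsymptotic (hX : IsCAT0 X) (hγ : HasUnitSpeedOn γ (Ici 0))
    (hτ : Tendsto (totalCurvature γ 0) atTop (𝓝 (τγ : ℝ≥0∞)))
    (hint : (∫⁻ t in Ici (0 : ℝ), ((τγ : ℝ≥0∞) - totalCurvature γ 0 t)) < ∞)
    (hσ : IsGeodesicRay σ) (ho : (fun t : ℝ => distToRay (γ t) σ) =o[atTop] (fun t : ℝ => t)) :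
    IsAsymptotic γ σ := by
  obtain ⟨C, hC⟩ := hX.bddAbove_distToRay_natCast hγ hτ hint hσ ho
  refine ⟨C + 1, fun t ht => ?_⟩
  have hn : (0 : ℝ) ≤ ⌊t⌋₊ := Nat.cast_nonneg _
  calc distToRay (γ t) σ ≤ distToRay (γ ⌊t⌋₊) σ + dist (γ ⌊t⌋₊) (γ t) :=
        Metric.infDist_le_infDist_add_dist.trans_eq (by rw [dist_comm]; rfl)
    _ ≤ C + (t - ⌊t⌋₊) := add_le_add (hC (mem_range_self _))
        (dist_le_of_hasUnitSpeedOn hγ hn ht (Nat.floor_le ht))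
    _ ≤ C + 1 := by linarith [Nat.lt_floor_add_one t]

end FiniteTotalCurvature

end CatZero

theorem mainTheorem3 {X : Type*} [MetricSpace X] (hX : CatZero.IsCAT0 X)
    (γ : ℝ → X) (hγ : HasUnitSpeedOn γ (Set.Ici 0))
    (τγ : ℝ≥0)
    (hτ : Filter.Tendsto (fun t : ℝ => CatZero.totalCurvature γ 0 t) Filter.atTop
      (𝓝 (τγ : ℝ≥0∞))) :
    (CompleteSpace X → ∀ p : X, ∃ σ : ℝ → X, CatZero.IsGeodesicRay σ ∧ σ 0 = p ∧
      (fun t : ℝ => CatZero.distToRay (γ t) σ) =o[Filter.atTop] (fun t : ℝ => t)) ∧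
    ((fun t : ℝ => t) =O[Filter.atTop] CatZero.circumradius γ) ∧
    ((∫⁻ t in Set.Ici (0 : ℝ), ((τγ : ℝ≥0∞) - CatZero.totalCurvature γ 0 t)) < ∞ →
      ∀ σ : ℝ → X, CatZero.IsGeodesicRay σ →
        (fun t : ℝ => CatZero.distToRay (γ t) σ) =o[Filter.atTop] (fun t : ℝ => t) →
        CatZero.IsAsymptotic γ σ) :=
  have hκ := CatZero.hasVanishingTailCurvature_of_tendsto hγ hτ
  ⟨fun _ p => hX.exists_isGeodesicRay hγ hκ p, hX.isBigO_circumradius hγ hκ,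
    fun hint _ hσ ho => hX.isAsymptotic hγ hτ hint hσ ho⟩
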